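/- Let $T>0$, let $W=(W^1,\dots,W^m)$ be a standard $m$-dimensional Brownian motion on $[0,T]$ (with continuous paths) and let $\gamma\in(0,\tfrac12)$. Write $\Delta_n=\{(s_1,\dots,s_n)\in[0,T]^n:\ s_1<\dots<s_n\}$. For $(s,t,\tau)\in\Delta_3$ let $$\mathbf z^{1,\tau}_{ts}=\int_s^t(\tau-r)^{-\gamma}\,dW_r\in\mathbb R^m ,$$ where the $i$-th coordinate is the Wiener integral $W^i(h^\tau_{ts})$ of $h^\tau_{ts}(r)=(\tau-r)^{-\gamma}\mathbf 1_{[s,t]}(r)$, i.e. the image of $h^\tau_{ts}$ under the continuous linear extension to $L^2([0,T])\to L^2(\Omega)$ of $\mathbf 1_{[0,t]}\mapsto W^i_t$. For $z:\Delta_3\to\mathbb R^m$, $(s,t,\tau)\mapsto z^\tau_{ts}$, put $\|z\|_{(\alpha,\gamma,\eta,\zeta)}=\|z\|_{(\alpha,\gamma),1}+\|z\|_{(\alpha,\gamma,\eta,\zeta),1,2}\in[0,\infty]$ with $$\|z\|_{(\alpha,\gamma),1}=\sup_{(s,t,\tau)\in\Delta_3}\frac{|z^\tau_{ts}|}{\left[|\tau-t|^{-\gamma}|t-s|^{\alpha}\right]\wedge|t-s|^{\alpha-\gamma}},$$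 $$\|z\|_{(\alpha,\gamma,\eta,\zeta),1,2}=\sup_{(s,t,\tau',\tau)\in\Delta_4}\frac{|z^{\tau}_{ts}-z^{\tau'}_{ts}|}{|\tau-\tau'|^{\eta}|\tau'-t|^{-(\eta-\zeta)}\left(\left[|\tau'-t|^{-\gamma-\zeta}|t-s|^{\alpha}\right]\wedge|t-s|^{\alpha-\gamma-\zeta}\right)},$$ and let $\mathcal V^{(\alpha,\gamma,\eta,\zeta)}(\Delta_3;\mathbb R^m)$ be the set of those $z$ with $\|z\|_{(\alpha,\gamma,\eta,\zeta)}<\infty$. Then $\mathbf z^1$ has a version that is almost surely continuous on $\Delta_3$, and every such version has the following properties. (i) For all $\alpha\in(0,\tfrac12)$ and $\eta,\zeta\in[0,1]$ with $\alpha-\gamma>0$, $0\le\zeta\le\inf(\alpha-\gamma,\eta)$ and $\eta>1-\alpha$, almost surely $\mathbf z^{1}\in\mathcal V^{(\alpha,\gamma,\eta,\zeta)}(\Delta_3;\mathbb R^m)$. (ii) For all $\alpha,\eta,\zeta$ as in (i), $\|\mathbf z^1\|_{(\alpha,\gamma,\eta,\zeta)}$ is measurable (up to a null set) and $\mathbb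 E\big[\|\mathbf z^1\|_{(\alpha,\gamma,\eta,\zeta)}^{2p}\big]<\infty$ for every real $p\ge1$. (iii) Almost surely, $\delta_u\mathbf z^{1,\tau}_{ts}:=\mathbf z^{1,\tau}_{ts}-\mathbf z^{1,\tau}_{tu}-\mathbf z^{1,\tau}_{us}=0$ for all $(s,u,t,\tau)\in\Delta_4$ simultaneously. -/

import Mathlib

open MeasureTheory ProbabilityTheory Filter Set
open scoped ENNReal Topology

namespace Volterra

noncomputable section

/-- The simplex `Δ_n^T = {(x₀, …, x_{n-1}) ∈ [0,T]^n : x₀ < ⋯ < x_{n-1}}`. -/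
def simplex (T : ℝ) (n : ℕ) : Set (Fin n → ℝ) :=
  {x | (∀ i, x i ∈ Icc 0 T) ∧ StrictMono x}

/-- `ψ¹_{(α,γ)}(τ,t,s) = (|τ-t|^{-γ} |t-s|^α) ∧ |t-s|^{α-γ}`. -/
def psi1 (α γ τ t s : ℝ) : ℝ :=
  min (|τ - t| ^ (-γ) * |t - s| ^ α) (|t - s| ^ (α - γ))

/-- `ψ^{1,2}_{(α,γ,η,ζ)}(τ,τ',t,s)`. -/
def psi12 (α γ η ζ τ τ' t s : ℝ) : ℝ :=
  |τ - τ'| ^ η * |τ' - t| ^ (-(η - ζ)) *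
    min (|τ' - t| ^ (-γ - ζ) * |t - s| ^ α) (|t - s| ^ (α - γ - ζ))

section Norms

variable {E : Type*} [NormedAddCommGroup E]

/-- The 1-norm: the supremum over `(s,t,τ) ∈ Δ_3` of `|z^τ_{ts}| / ψ¹(τ,t,s)`.
An increment is written `z τ t s`; only its values on `Δ_3` matter. -/
def norm1 (T α γ : ℝ) (z : ℝ → ℝ → ℝ → E) : ℝ≥0∞ :=
  ⨆ x ∈ simplex T 3,
    ‖z (x 2) (x 1) (x 0)‖ₑ / ENNReal.ofReal (psi1 α γ (x 2) (x 1) (x 0))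

/-- The (1,2)-norm: the supremum over `(s,t,τ',τ) ∈ Δ_4` of
`|z^τ_{ts} - z^{τ'}_{ts}| / ψ^{1,2}(τ,τ',t,s)`. -/
def norm12 (T α γ η ζ : ℝ) (z : ℝ → ℝ → ℝ → E) : ℝ≥0∞ :=
  ⨆ x ∈ simplex T 4,
    ‖z (x 3) (x 1) (x 0) - z (x 2) (x 1) (x 0)‖ₑ /
      ENNReal.ofReal (psi12 α γ η ζ (x 3) (x 2) (x 1) (x 0))

/-- The norm `‖z‖_{(α,γ,η,ζ)}`, with values in `[0,∞]`. -/
def volterraNorm (T α γ η ζ : ℝ) (z : ℝ → ℝ → ℝ → E) : ℝ≥0∞ :=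
  norm1 T α γ z + norm12 T α γ η ζ z

/-- The Volterra space `V^{(α,γ,η,ζ)}(Δ_3; E)`. -/
def volterraSpace (T α γ η ζ : ℝ) : Set (ℝ → ℝ → ℝ → E) :=
  {z | volterraNorm T α γ η ζ z < ∞}

/-- `δ_u g_{ts} = g_{ts} - g_{tu} - g_{us}`. -/
def delta (g : ℝ → ℝ → E) (t u s : ℝ) : E := g t s - g t u - g u s

end Norms

section Probability

variable {Ω : Type*} [MeasurableSpace Ω]

/-- A standard `m`-dimensional Brownian motion on `[0,T]`: the coordinates are independent,
each of them is a centered Gaussian process with covariance `s ∧ t`, and almost all paths are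
continuous. -/
structure IsBrownianMotion {T : ℝ} {m : ℕ} (W : Icc (0 : ℝ) T → Ω → EuclideanSpace ℝ (Fin m))
    (P : Measure Ω) : Prop where
  gaussian : ∀ i, IsGaussianProcess (fun t ω ↦ W t ω i) P
  centered : ∀ i t, ∫ ω, W t ω i ∂P = 0
  covariance : ∀ i s t, cov[fun ω ↦ W s ω i, fun ω ↦ W t ω i; P] = min (s : ℝ) t
  indep : iIndepFun (fun i ω t ↦ W t ω i) P
  continuous_paths : ∀ᵐ ω ∂P, Continuous fun t ↦ W t ω

/-- The step function `∑ₖ cₖ 1_{[0,tₖ]}`. -/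
def stepFunction {T : ℝ} (c : Icc (0 : ℝ) T →₀ ℝ) (r : ℝ) : ℝ :=
  c.sum fun t a ↦ a * (Icc (0 : ℝ) t).indicator 1 r

/-- The integral `∑ₖ cₖ X_{tₖ}` of the step function `∑ₖ cₖ 1_{[0,tₖ]}` against `X`. -/
def stepIntegral {T : ℝ} (X : Icc (0 : ℝ) T → Ω → ℝ) (c : Icc (0 : ℝ) T →₀ ℝ) (ω : Ω) : ℝ :=
  c.sum fun t a ↦ a * X t ω

/-- `Y` is (a version of) the Wiener integral `X(h)` of `h ∈ L²([0,T])` against the real Brownian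
motion `X`: the image of `h` under the `L²`-continuous extension of the linear map
`1_{[0,t]} ↦ X_t`. That is, for some step functions converging to `h` in `L²([0,T])`, their
integrals converge to `Y` in `L²(Ω)`. -/
def IsWienerIntegral {T : ℝ} (X : Icc (0 : ℝ) T → Ω → ℝ) (P : Measure Ω) (h : ℝ → ℝ)
    (Y : Ω → ℝ) : Prop :=
  MemLp h 2 (volume.restrict (Icc 0 T)) ∧ MemLp Y 2 P ∧
    ∃ c : ℕ → (Icc (0 : ℝ) T →₀ ℝ),
      Tendsto (fun n ↦ eLpNorm (fun r ↦ stepFunction (c n) r - h r) 2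
        (volume.restrict (Icc 0 T))) atTop (𝓝 0) ∧
      Tendsto (fun n ↦ eLpNorm (fun ω ↦ stepIntegral X (c n) ω - Y ω) 2 P) atTop (𝓝 0)

/-- The kernel `h^τ_{ts}(r) = (τ-r)^{-γ} 1_{[s,t]}(r)`. -/
def kernel (γ τ t s : ℝ) (r : ℝ) : ℝ := (Icc s t).indicator (fun r ↦ (τ - r) ^ (-γ)) r

/-- `z` is a continuous version of the first level
`z^{1,τ,i}_{ts} = ∫_s^t (τ-r)^{-γ} dW^i_r = W^i(h^τ_{ts})`, `(s,t,τ) ∈ Δ_3`. -/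
structure IsFirstLevel {T : ℝ} {m : ℕ} (W : Icc (0 : ℝ) T → Ω → EuclideanSpace ℝ (Fin m))
    (P : Measure Ω) (γ : ℝ) (z : Ω → ℝ → ℝ → ℝ → EuclideanSpace ℝ (Fin m)) : Prop where
  isWienerIntegral : ∀ x ∈ simplex T 3, ∀ i,
    IsWienerIntegral (fun t ω ↦ W t ω i) P (kernel γ (x 2) (x 1) (x 0))
      (fun ω ↦ z ω (x 2) (x 1) (x 0) i)
  continuous : ∀ᵐ ω ∂P, ContinuousOn (fun x : Fin 3 → ℝ ↦ z ω (x 2) (x 1) (x 0)) (simplex T 3)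

end Probability

end

end Volterra

/-! For t < τ the kernel r ↦ (τ-r)^{-γ} is smooth on [s,t], so ∫_s^t (τ-r)^{-γ} dW_r can be defined
path by path through integration by parts. This gives the candidate version `pathLevel`, and the
analytic claims become statements about a fixed continuous path f. Joint continuity on the simplex
and additivity in the interval are immediate.

For the norms, subtract the endpoint value: the integral becomes k(s)(f(t)-f(s)) + ∫
k'(r)(f(t)-f(r)) dr. Either k' ≥ 0 is integrated exactly, giving the bounds singular in τ-t, or its
singularity at r = t is absorbed by the Hölder decay of f(t)-f(r), giving the bounds in t-s alone.
The difference of the kernels for τ' and τ has the same shape, so it obeys the same two estimates.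
Thus the (α,γ,η,ζ)-norm is at most a constant times the α'-Hölder constant of f, for any α' > α
(`exists_volterraNorm_pathLevel_le`). With α < α' < 1/2, Gaussian increments and dyadic chaining
give that constant moments of every order (`IsBrownianMotion.exists_holder`).

Two facts tie the candidate to the Wiener integral. Left-endpoint Riemann sums converge to the
kernel in L²([0,T]) and to `pathLevel` in L²(Ω) (`IsBrownianMotion.isWienerIntegral_pathLevel`). The
Itô isometry on step functions makes Wiener integrals unique up to null sets. Hence any continuous
version agrees almost surely with the candidate on a countable dense set, so everywhere on the
simplex, and inherits all its properties. Density of a countable set also makes the suprema in the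
norm measurable. -/

namespace Volterra

/-! ### Integration by parts against a path -/

section ByParts

variable {E : Type*} [NormedAddCommGroup E] [NormedSpace ℝ E]

/-- The integral `∫_s^t k df` defined by integration by parts, where `k'` is the derivative
of `k`. -/
noncomputable def byParts (k k' : ℝ → ℝ) (f : ℝ → E) (s t : ℝ) : E :=
  k t • f t - k s • f s - ∫ r in s..t, k' r • f r

variable {k k' : ℝ → ℝ} {f : ℝ → E} {s t : ℝ}

theorem byParts_add {u : ℝ} (hsu : s ≤ u) (hut : u ≤ t) (hk' : ContinuousOn k' (Icc s t))
    (hf : Continuous f) : byParts k k' f s u + byParts k k' f u t = byParts k k' f s t := by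
  have h1 : IntervalIntegrable (fun r ↦ k' r • f r) volume s u :=
    ((hk'.mono (Icc_subset_Icc_right hut)).smul hf.continuousOn).intervalIntegrable_of_Icc hsu
  have h2 : IntervalIntegrable (fun r ↦ k' r • f r) volume u t :=
    ((hk'.mono (Icc_subset_Icc_left hsu)).smul hf.continuousOn).intervalIntegrable_of_Icc hut
  simp only [byParts, ← intervalIntegral.integral_add_adjacent_intervals h1 h2]
  abel

theorem byParts_sub {l l' : ℝ → ℝ} (hst : s ≤ t) (hk' : ContinuousOn k' (Icc s t))
    (hl' : ContinuousOn l' (Icc s t)) (hf : Continuous f) :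
    byParts (fun r ↦ k r - l r) (fun r ↦ k' r - l' r) f s t =
      byParts k k' f s t - byParts l l' f s t := by
  have h1 : IntervalIntegrable (fun r ↦ k' r • f r) volume s t :=
    (hk'.smul hf.continuousOn).intervalIntegrable_of_Icc hst
  have h2 : IntervalIntegrable (fun r ↦ l' r • f r) volume s t :=
    (hl'.smul hf.continuousOn).intervalIntegrable_of_Icc hst
  simp only [byParts, sub_smul, intervalIntegral.integral_sub h1 h2]
  abel

variable [CompleteSpace E]

/-- The increment f(t) - f(r) vanishes at r = t, the end where k' is close to singular; the boundary
term now involves k only at the far endpoint s. -/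
theorem byParts_eq (hst : s ≤ t) (hk : ∀ r ∈ Icc s t, HasDerivAt k (k' r) r)
    (hk' : ContinuousOn k' (Icc s t)) (hf : Continuous f) :
    byParts k k' f s t = k s • (f t - f s) + ∫ r in s..t, k' r • (f t - f r) := by
  have h0 : IntervalIntegrable k' volume s t := hk'.intervalIntegrable_of_Icc hst
  have h1 : IntervalIntegrable (fun r ↦ k' r • f r) volume s t :=
    (hk'.smul hf.continuousOn).intervalIntegrable_of_Icc hst
  have h2 : IntervalIntegrable (fun r ↦ k' r • f t) volume s t :=
    (hk'.smul continuousOn_const).intervalIntegrable_of_Icc hst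
  simp only [byParts, smul_sub, intervalIntegral.integral_sub h2 h1,
    intervalIntegral.integral_smul_const]
  rw [intervalIntegral.integral_eq_sub_of_hasDerivAt (by rwa [uIcc_of_le hst]) h0, sub_smul]
  abel

/-- Since k' ≥ 0, the integral of k' is the increase of k. The estimate serves twice: for the crude
bound `norm_byParts_le`, and as the one-cell error of a left-endpoint Riemann sum. -/
theorem norm_smul_sub_sub_byParts_le (hst : s ≤ t) (hk : ∀ r ∈ Icc s t, HasDerivAt k (k' r) r)
    (hk' : ContinuousOn k' (Icc s t)) (hk'0 : ∀ r ∈ Icc s t, 0 ≤ k' r) (hf : Continuous f)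
    {M : ℝ} (hM : ∀ r ∈ Icc s t, ‖f t - f r‖ ≤ M) :
    ‖k s • (f t - f s) - byParts k k' f s t‖ ≤ M * (k t - k s) := by
  have h0 : IntervalIntegrable k' volume s t := hk'.intervalIntegrable_of_Icc hst
  rw [byParts_eq hst hk hk' hf, sub_add_cancel_left, norm_neg,
    ← intervalIntegral.integral_eq_sub_of_hasDerivAt (by rwa [uIcc_of_le hst]) h0,
    ← intervalIntegral.integral_const_mul]
  refine intervalIntegral.norm_integral_le_of_norm_le hst ?_ (h0.const_mul M)
  filter_upwards with r hr
  have hr' := Ioc_subset_Icc_self hr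
  rw [norm_smul, Real.norm_of_nonneg (hk'0 r hr'), mul_comm]
  exact mul_le_mul_of_nonneg_right (hM r hr') (hk'0 r hr')

theorem norm_byParts_le (hst : s ≤ t) (hk : ∀ r ∈ Icc s t, HasDerivAt k (k' r) r)
    (hk' : ContinuousOn k' (Icc s t)) (hks : 0 ≤ k s) (hk'0 : ∀ r ∈ Icc s t, 0 ≤ k' r)
    (hf : Continuous f) {M : ℝ} (hM : ∀ r ∈ Icc s t, ‖f t - f r‖ ≤ M) :
    ‖byParts k k' f s t‖ ≤ M * k t := by
  have h1 := norm_smul_sub_sub_byParts_le hst hk hk' hk'0 hf hM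
  have h2 : ‖k s • (f t - f s)‖ ≤ M * k s := by
    rw [norm_smul, Real.norm_of_nonneg hks, mul_comm]
    exact mul_le_mul_of_nonneg_right (hM s (left_mem_Icc.2 hst)) hks
  have h3 := norm_sub_norm_le (byParts k k' f s t) (k s • (f t - f s))
  rw [norm_sub_rev] at h3
  linarith

/-- The factor (t-r)^α turns the singularity (t-r)^{-β-1} of k' into (t-r)^{α-β-1}, which is
integrable because β < α. -/
theorem norm_byParts_le_of_holder (hst : s < t) (hk : ∀ r ∈ Icc s t, HasDerivAt k (k' r) r)
    (hk' : ContinuousOn k' (Icc s t)) (hks : 0 ≤ k s) (hk'0 : ∀ r ∈ Icc s t, 0 ≤ k' r)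
    (hf : Continuous f) {K C D α β : ℝ} (hK : 0 ≤ K) (hβ : β < α)
    (hfK : ∀ r ∈ Icc s t, ‖f t - f r‖ ≤ K * (t - r) ^ α)
    (hC : k s ≤ C * (t - s) ^ (-β)) (hD : ∀ r ∈ Ico s t, k' r ≤ D * (t - r) ^ (-β - 1)) :
    ‖byParts k k' f s t‖ ≤ K * (C + D / (α - β)) * (t - s) ^ (α - β) := by
  have hts : 0 < t - s := sub_pos.2 hst
  have hint : IntervalIntegrable (fun r ↦ (t - r) ^ (α - β - 1)) volume s t := by
    have := (intervalIntegral.intervalIntegrable_rpow' (a := 0) (b := t - s)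
      (r := α - β - 1) (by linarith)).comp_sub_left t
    simpa using this.symm
  have hval : ∫ r in s..t, (t - r) ^ (α - β - 1) = (t - s) ^ (α - β) / (α - β) := by
    rw [intervalIntegral.integral_comp_sub_left (fun x ↦ x ^ (α - β - 1)) t, sub_self,
      integral_rpow (Or.inl (by linarith)), sub_add_cancel, Real.zero_rpow (by linarith), sub_zero]
  rw [byParts_eq hst.le hk hk' hf]
  refine (norm_add_le _ _).trans ?_
  have h1 : ‖k s • (f t - f s)‖ ≤ K * C * (t - s) ^ (α - β) := by
    rw [norm_smul, Real.norm_of_nonneg hks]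
    calc k s * ‖f t - f s‖ ≤ (C * (t - s) ^ (-β)) * (K * (t - s) ^ α) :=
          mul_le_mul hC (hfK s (left_mem_Icc.2 hst.le)) (norm_nonneg _) (hks.trans hC)
      _ = K * C * (t - s) ^ (α - β) := by
          rw [show α - β = -β + α by ring, Real.rpow_add hts]; ring
  have h2 : ‖∫ r in s..t, k' r • (f t - f r)‖ ≤ K * D * ((t - s) ^ (α - β) / (α - β)) := by
    rw [← hval, ← intervalIntegral.integral_const_mul]
    refine intervalIntegral.norm_integral_le_of_norm_le hst.le ?_ (hint.const_mul _)
    filter_upwards with r hr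
    rcases eq_or_lt_of_le hr.2 with rfl | hrt
    · simp only [sub_self, smul_zero, norm_zero]
      -- At the right endpoint the bound on k' is unavailable. The left side is zero, while the
      -- right side contains `0 ^ (α - β - 1)`, equal to 1 for exponent zero; then D ≥ 0 is needed,
      -- and is read off from `hD` at s.
      by_cases h : α - β - 1 = 0
      · have hs := hD s ⟨le_rfl, hst⟩
        rw [h, Real.rpow_zero, mul_one]
        have : 0 ≤ D * (r - s) ^ (-β - 1) := (hk'0 s (left_mem_Icc.2 hst.le)).trans hs
        exact mul_nonneg hK (nonneg_of_mul_nonneg_left this (by positivity))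
      · rw [Real.zero_rpow h, mul_zero]
    · have hr' : r ∈ Icc s t := Ioc_subset_Icc_self hr
      have htr : 0 < t - r := sub_pos.2 hrt
      rw [norm_smul, Real.norm_of_nonneg (hk'0 r hr')]
      have hDr := hD r ⟨hr'.1, hrt⟩
      calc k' r * ‖f t - f r‖ ≤ (D * (t - r) ^ (-β - 1)) * (K * (t - r) ^ α) :=
            mul_le_mul hDr (hfK r hr') (norm_nonneg _) ((hk'0 r hr').trans hDr)
        _ = K * D * (t - r) ^ (α - β - 1) := by
            rw [show α - β - 1 = (-β - 1) + α by ring, Real.rpow_add htr]; ring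
  calc _ ≤ K * C * (t - s) ^ (α - β) + K * D * ((t - s) ^ (α - β) / (α - β)) := add_le_add h1 h2
    _ = _ := by ring

end ByParts

/-! ### The pathwise first level -/

/-- By homogeneity one may take a = 1 and b = x. Then 1 - x^{-c} is at most both 1 and c(x-1), and
one of these is below (1+c)(x-1)^η according to whether x - 1 exceeds 1. -/
theorem rpow_neg_sub_rpow_neg_le {a b c η : ℝ} (ha : 0 < a) (hab : a ≤ b) (hc : 0 ≤ c)
    (hη0 : 0 ≤ η) (hη1 : η ≤ 1) :
    a ^ (-c) - b ^ (-c) ≤ (1 + c) * (b - a) ^ η * a ^ (-c - η) := by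
  obtain ⟨x, rfl⟩ : ∃ x, b = a * x := ⟨b / a, by field_simp⟩
  have hx : 1 ≤ x := by
    by_contra! h
    nlinarith
  have hx0 : 0 < x := by linarith
  have key : 1 - x ^ (-c) ≤ (1 + c) * (x - 1) ^ η := by
    rcases le_total 1 (x - 1) with h | h
    · have h1 : 1 ≤ (x - 1) ^ η := Real.one_le_rpow h hη0
      have h2 : 0 ≤ x ^ (-c) := Real.rpow_nonneg hx0.le _
      nlinarith
    · have h1 : x - 1 ≤ (x - 1) ^ η := Real.self_le_rpow_of_le_one (by linarith) h hη1
      have h2 : 1 - c * (x - 1) ≤ x ^ (-c) := by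
        rw [Real.rpow_def_of_pos hx0]
        have h3 := Real.add_one_le_exp (Real.log x * -c)
        have h4 := Real.log_le_sub_one_of_pos hx0
        nlinarith
      nlinarith
  have e1 : a * x - a = a * (x - 1) := by ring
  rw [Real.mul_rpow ha.le hx0.le, e1, Real.mul_rpow ha.le (by linarith), Real.rpow_sub ha]
  have hp : 0 < a ^ η := Real.rpow_pos_of_pos ha _
  have hq : 0 < a ^ (-c) := Real.rpow_pos_of_pos ha _
  calc a ^ (-c) - a ^ (-c) * x ^ (-c) = a ^ (-c) * (1 - x ^ (-c)) := by ring
    _ ≤ a ^ (-c) * ((1 + c) * (x - 1) ^ η) := mul_le_mul_of_nonneg_left key hq.le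
    _ = _ := by field_simp

theorem hasDerivAt_sub_rpow_neg {γ τ r : ℝ} (hr : r < τ) :
    HasDerivAt (fun r ↦ (τ - r) ^ (-γ)) (γ * (τ - r) ^ (-γ - 1)) r := by
  have h := ((hasDerivAt_id r).const_sub τ).rpow_const (p := -γ) (Or.inl (sub_pos.2 hr).ne')
  simpa only [id, neg_one_mul, neg_neg] using h

theorem continuousOn_mul_sub_rpow {γ τ s t : ℝ} (c : ℝ) (ht : t < τ) :
    ContinuousOn (fun r ↦ c * (τ - r) ^ γ) (Icc s t) :=
  continuousOn_const.mul ((continuousOn_const.sub continuousOn_id).rpow_const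
    fun _ hr ↦ Or.inl (sub_pos.2 (hr.2.trans_lt ht)).ne')

variable {E : Type*} [NormedAddCommGroup E] [NormedSpace ℝ E]

/-- The pathwise integral `∫_s^t (τ-r)^{-γ} df_r`. -/
noncomputable def pathLevel (γ : ℝ) (f : ℝ → E) (τ t s : ℝ) : E :=
  byParts (fun r ↦ (τ - r) ^ (-γ)) (fun r ↦ γ * (τ - r) ^ (-γ - 1)) f s t

theorem delta_pathLevel {γ τ t u s : ℝ} {f : ℝ → E} (hf : Continuous f) (hsu : s ≤ u)
    (hut : u ≤ t) (ht : t < τ) : delta (pathLevel γ f τ) t u s = 0 := by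
  rw [delta, sub_sub, sub_eq_zero, add_comm]
  exact (byParts_add hsu hut (continuousOn_mul_sub_rpow _ ht) hf).symm

theorem continuousOn_pathLevel {T γ : ℝ} {f : ℝ → E} (hf : Continuous f) :
    ContinuousOn (fun x : Fin 3 → ℝ ↦ pathLevel γ f (x 2) (x 1) (x 0)) (simplex T 3) := by
  have h01 : ∀ x : simplex T 3, x.1 0 < x.1 1 := fun x ↦ x.2.2 (by decide)
  have h12 : ∀ x : simplex T 3, x.1 1 < x.1 2 := fun x ↦ x.2.2 (by decide)
  have hc : ∀ i, Continuous fun x : simplex T 3 ↦ x.1 i :=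
    fun i ↦ (continuous_apply i).comp continuous_subtype_val
  rw [continuousOn_iff_continuous_domRestrict]
  -- The maximum with τ - t changes nothing for r ≤ t and keeps the integrand jointly continuous for
  -- all r. Splitting at 0 then leaves integrals with a single moving endpoint.
  have hF : Continuous (Function.uncurry fun (x : simplex T 3) (r : ℝ) ↦
      (γ * (max (x.1 2 - r) (x.1 2 - x.1 1)) ^ (-γ - 1)) • f r) := by
    refine Continuous.smul (continuous_const.mul (Continuous.rpow_const ?_ ?_))
      (hf.comp continuous_snd)
    · have h1 := (hc 1).comp (continuous_fst (X := simplex T 3) (Y := ℝ))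
      have h2 := (hc 2).comp (continuous_fst (X := simplex T 3) (Y := ℝ))
      exact (h2.sub continuous_snd).max (h2.sub h1)
    · rintro ⟨x, r⟩
      exact Or.inl (lt_max_of_lt_right (sub_pos.2 (h12 x))).ne'
  have hint : ∀ (x : simplex T 3) (a b : ℝ), IntervalIntegrable (fun r ↦
      (γ * (max (x.1 2 - r) (x.1 2 - x.1 1)) ^ (-γ - 1)) • f r) volume a b :=
    fun x a b ↦ (hF.comp (Continuous.prodMk_right x)).intervalIntegrable a b
  have heq : ((simplex T 3).domRestrict fun x : Fin 3 → ℝ ↦ pathLevel γ f (x 2) (x 1) (x 0)) =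
      fun x : simplex T 3 ↦ (x.1 2 - x.1 1) ^ (-γ) • f (x.1 1) -
        (x.1 2 - x.1 0) ^ (-γ) • f (x.1 0) -
        ((∫ r in (0 : ℝ)..x.1 1, (γ * (max (x.1 2 - r) (x.1 2 - x.1 1)) ^ (-γ - 1)) • f r) -
         ∫ r in (0 : ℝ)..x.1 0, (γ * (max (x.1 2 - r) (x.1 2 - x.1 1)) ^ (-γ - 1)) • f r) := by
    funext x
    rw [intervalIntegral.integral_interval_sub_left (hint x _ _) (hint x _ _)]
    have h : ∫ r in x.1 0..x.1 1, (γ * (max (x.1 2 - r) (x.1 2 - x.1 1)) ^ (-γ - 1)) • f r =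
        ∫ r in x.1 0..x.1 1, (γ * (x.1 2 - r) ^ (-γ - 1)) • f r := by
      refine intervalIntegral.integral_congr fun r hr ↦ ?_
      rw [uIcc_of_le (h01 x).le] at hr
      simp only [max_eq_left (sub_le_sub_left hr.2 (x.1 2))]
    rw [h]
    rfl
  rw [heq]
  refine Continuous.sub (Continuous.sub ?_ ?_) (Continuous.sub ?_ ?_)
  · exact (((hc 2).sub (hc 1)).rpow_const fun x ↦ Or.inl (sub_pos.2 (h12 x)).ne').smul
      (hf.comp (hc 1))
  · exact (((hc 2).sub (hc 0)).rpow_const fun x ↦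
      Or.inl (sub_pos.2 ((h01 x).trans (h12 x))).ne').smul (hf.comp (hc 0))
  · exact intervalIntegral.continuous_parametric_intervalIntegral_of_continuous hF (hc 1)
  · exact intervalIntegral.continuous_parametric_intervalIntegral_of_continuous hF (hc 0)

end Volterra

namespace Volterra

/-! ### Volterra estimates for the integral against a Hölder path -/

section PathBounds

variable {E : Type*} [NormedAddCommGroup E] [NormedSpace ℝ E] [CompleteSpace E]

/-- The first entry of the minimum comes from monotonicity of the kernel, the second from the
singular estimate with β = γ, C = 1, D = γ, using τ - r ≥ t - r. -/
theorem norm_pathLevel_le {α γ K τ t s : ℝ} {f : ℝ → E} (hγ : 0 < γ) (hα : γ < α) (hK : 0 ≤ K)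
    (hf : Continuous f) (hfK : ∀ r ∈ Icc s t, ‖f t - f r‖ ≤ K * (t - r) ^ α)
    (hst : s < t) (htτ : t < τ) :
    ‖pathLevel γ f τ t s‖ ≤ K * (1 + γ / (α - γ)) * psi1 α γ τ t s := by
  have hts : 0 < t - s := sub_pos.2 hst
  have hτ : 0 < τ - t := sub_pos.2 htτ
  have hk : ∀ r ∈ Icc s t, HasDerivAt (fun r ↦ (τ - r) ^ (-γ)) (γ * (τ - r) ^ (-γ - 1)) r :=
    fun r hr ↦ hasDerivAt_sub_rpow_neg (hr.2.trans_lt htτ)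
  have hk' : ContinuousOn (fun r ↦ γ * (τ - r) ^ (-γ - 1)) (Icc s t) :=
    continuousOn_mul_sub_rpow _ htτ
  have hks : 0 ≤ (τ - s) ^ (-γ) := Real.rpow_nonneg (by linarith) _
  have hk0 : ∀ r ∈ Icc s t, 0 ≤ γ * (τ - r) ^ (-γ - 1) := fun r hr ↦
    mul_nonneg hγ.le (Real.rpow_nonneg (by linarith [hr.2]) _)
  have hα0 : 0 < α := hγ.trans hα
  rw [psi1, abs_of_pos hτ, abs_of_pos hts, mul_min_of_nonneg _ _ (by
    have := sub_pos.2 hα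
    positivity)]
  refine le_min ?_ ?_
  · have hM : ∀ r ∈ Icc s t, ‖f t - f r‖ ≤ K * (t - s) ^ α := fun r hr ↦ by
      refine (hfK r hr).trans ?_
      gcongr
      · linarith [hr.2]
      · exact hr.1
    refine (norm_byParts_le hst.le hk hk' hks hk0 hf hM).trans ?_
    have h1 : 0 ≤ γ / (α - γ) := by
      have := sub_pos.2 hα
      positivity
    have h2 : 0 ≤ K * ((τ - t) ^ (-γ) * (t - s) ^ α) := by positivity
    nlinarith
  · refine norm_byParts_le_of_holder hst hk hk' hks hk0 hf hK hα hfK ?_ ?_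
    · rw [one_mul]
      exact Real.rpow_le_rpow_of_nonpos hts (by linarith) (by linarith)
    · intro r hr
      exact mul_le_mul_of_nonneg_left
        (Real.rpow_le_rpow_of_nonpos (by linarith [hr.2]) (by linarith) (by linarith)) hγ.le

/-- The exponent -c-η is split as -(η-ζ) + (-c-ζ); then τ'-s is bounded below by τ'-t in one factor
and by t-s in the other. -/
theorem sub_rpow_neg_sub_le {c η ζ τ τ' t s : ℝ} (hc : 0 ≤ c) (hη0 : 0 ≤ η) (hη1 : η ≤ 1)
    (hζη : ζ ≤ η) (hcζ : 0 ≤ c + ζ) (hst : s < t) (htτ' : t < τ') (hττ' : τ' < τ) :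
    (τ' - s) ^ (-c) - (τ - s) ^ (-c) ≤
      (1 + c) * ((τ - τ') ^ η * (τ' - t) ^ (-(η - ζ))) * (t - s) ^ (-c - ζ) := by
  have h0 : 0 < τ' - s := by linarith
  have h1 := rpow_neg_sub_rpow_neg_le (b := τ - s) h0 (by linarith) hc hη0 hη1
  rw [show τ - s - (τ' - s) = τ - τ' by ring, show -c - η = -(η - ζ) + (-c - ζ) by ring,
    Real.rpow_add h0] at h1
  have h2 : (τ' - s) ^ (-(η - ζ)) ≤ (τ' - t) ^ (-(η - ζ)) :=
    Real.rpow_le_rpow_of_nonpos (by linarith) (by linarith) (by linarith)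
  have h3 : (τ' - s) ^ (-c - ζ) ≤ (t - s) ^ (-c - ζ) :=
    Real.rpow_le_rpow_of_nonpos (by linarith) (by linarith) (by linarith)
  have h4 : 0 ≤ (τ - τ') ^ η := Real.rpow_nonneg (by linarith) _
  have h5 : 0 ≤ (τ' - t) ^ (-(η - ζ)) := Real.rpow_nonneg (by linarith) _
  have h6 : 0 ≤ (τ' - s) ^ (-c - ζ) := Real.rpow_nonneg h0.le _
  calc _ ≤ _ := h1
    _ ≤ (1 + c) * (τ - τ') ^ η * ((τ' - t) ^ (-(η - ζ)) * (t - s) ^ (-c - ζ)) := by gcongr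
    _ = _ := by ring

/-- The difference (τ'-r)^{-γ} - (τ-r)^{-γ} is again nonnegative and increasing in r, so both
estimates apply, the singular one with β = γ + ζ. The surplus α' > α keeps β < α' even when ζ = α -
γ, at the cost of T^{α'-α}. -/
theorem norm_pathLevel_sub_le {T α α' γ η ζ K τ τ' t s : ℝ} {f : ℝ → E} (hγ : 0 < γ)
    (hα : γ < α) (hαα' : α < α') (hη0 : 0 ≤ η) (hη1 : η ≤ 1) (hζ0 : 0 ≤ ζ) (hζα : ζ ≤ α - γ)
    (hζη : ζ ≤ η) (hK : 0 ≤ K) (hf : Continuous f)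
    (hfK : ∀ r ∈ Icc s t, ‖f t - f r‖ ≤ K * (t - r) ^ α')
    (hs : 0 ≤ s) (hst : s < t) (htτ' : t < τ') (hττ' : τ' < τ) (hτ : τ ≤ T) :
    ‖pathLevel γ f τ t s - pathLevel γ f τ' t s‖ ≤
      K * T ^ (α' - α) * (1 + γ + γ * (2 + γ) / (α' - (γ + ζ))) * psi12 α γ η ζ τ τ' t s := by
  have hts : 0 < t - s := sub_pos.2 hst
  have h1 : 0 < τ' - t := sub_pos.2 htτ'
  have h2 : 0 < τ - τ' := sub_pos.2 hττ'
  have hT : 0 < T := by linarith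
  have hα0 : 0 < α := hγ.trans hα
  have hd : 0 < α' - (γ + ζ) := by linarith
  have hTα : (t - s) ^ (α' - α) ≤ T ^ (α' - α) :=
    Real.rpow_le_rpow hts.le (by linarith) (by linarith)
  have hk : ∀ r ∈ Icc s t, HasDerivAt (fun r ↦ (τ' - r) ^ (-γ) - (τ - r) ^ (-γ))
      (γ * (τ' - r) ^ (-γ - 1) - γ * (τ - r) ^ (-γ - 1)) r := fun r hr ↦
    (hasDerivAt_sub_rpow_neg (hr.2.trans_lt htτ')).sub
      (hasDerivAt_sub_rpow_neg ((hr.2.trans_lt htτ').trans hττ'))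
  have hc1 := continuousOn_mul_sub_rpow (γ := -γ - 1) (s := s) γ htτ'
  have hc2 := continuousOn_mul_sub_rpow (γ := -γ - 1) (s := s) γ (htτ'.trans hττ')
  have hk' := hc1.sub hc2
  have hks : 0 ≤ (τ' - s) ^ (-γ) - (τ - s) ^ (-γ) := sub_nonneg.2
    (Real.rpow_le_rpow_of_nonpos (by linarith) (by linarith) (by linarith))
  have hk0 : ∀ r ∈ Icc s t, 0 ≤ γ * (τ' - r) ^ (-γ - 1) - γ * (τ - r) ^ (-γ - 1) :=
    fun r hr ↦ sub_nonneg.2 (mul_le_mul_of_nonneg_left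
      (Real.rpow_le_rpow_of_nonpos (by linarith [hr.2]) (by linarith) (by linarith)) hγ.le)
  rw [norm_sub_rev, pathLevel, pathLevel, ← byParts_sub hst.le hc1 hc2 hf, psi12, abs_of_pos h2,
    abs_of_pos h1, abs_of_pos hts, ← mul_assoc, mul_min_of_nonneg _ _ (by positivity)]
  set Q := (τ - τ') ^ η * (τ' - t) ^ (-(η - ζ)) with hQ
  have hQ0 : 0 ≤ Q := by positivity
  refine le_min ?_ ?_
  · have hM : ∀ r ∈ Icc s t, ‖f t - f r‖ ≤ K * T ^ (α' - α) * (t - s) ^ α := fun r hr ↦ by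
      refine (hfK r hr).trans ?_
      calc K * (t - r) ^ α' ≤ K * (t - s) ^ α' := by
            have h3 := hr.1
            have h4 := hr.2
            have h5 : 0 ≤ t - r := by linarith
            have h6 : 0 ≤ α' := by linarith
            gcongr
        _ = K * (t - s) ^ (α' - α) * (t - s) ^ α := by
            rw [mul_assoc, ← Real.rpow_add hts, sub_add_cancel]
        _ ≤ _ := by gcongr
    refine (norm_byParts_le hst.le hk hk' hks hk0 hf hM).trans ?_
    have h3 := rpow_neg_sub_rpow_neg_le (b := τ - t) h1 (by linarith) hγ.le hη0 hη1
    rw [show τ - t - (τ' - t) = τ - τ' by ring, show -γ - η = -(η - ζ) + (-γ - ζ) by ring,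
      Real.rpow_add h1] at h3
    calc K * T ^ (α' - α) * (t - s) ^ α * ((τ' - t) ^ (-γ) - (τ - t) ^ (-γ))
        ≤ K * T ^ (α' - α) * (t - s) ^ α * ((1 + γ) * (τ - τ') ^ η *
            ((τ' - t) ^ (-(η - ζ)) * (τ' - t) ^ (-γ - ζ))) := by gcongr
      _ = K * T ^ (α' - α) * (1 + γ + 0) * Q * ((τ' - t) ^ (-γ - ζ) * (t - s) ^ α) := by
          rw [hQ]; ring
      _ ≤ _ := by
          gcongr
          positivity
  · have hC := sub_rpow_neg_sub_le hγ.le hη0 hη1 hζη (by linarith) hst htτ' hττ'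
    -- The derivative is γ times the same kind of difference with c = γ + 1, whence the factor
    -- γ(2+γ).
    have hD : ∀ r ∈ Ico s t, γ * (τ' - r) ^ (-γ - 1) - γ * (τ - r) ^ (-γ - 1) ≤
        γ * (2 + γ) * Q * (t - r) ^ (-(γ + ζ) - 1) := fun r hr ↦ by
      have h3 := sub_rpow_neg_sub_le (c := γ + 1) (by linarith) hη0 hη1 hζη (by linarith) hr.2
        htτ' hττ'
      rw [← mul_sub]
      calc _ ≤ γ * _ := mul_le_mul_of_nonneg_left
            (by simpa only [neg_add, sub_eq_add_neg] using h3) hγ.le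
        _ = _ := by
          rw [hQ, show -γ + -1 + -ζ = -(γ + ζ) - 1 by ring, sub_eq_add_neg η ζ, neg_add]
          ring_nf
    rw [show -γ - ζ = -(γ + ζ) by ring, ← hQ] at hC
    refine (norm_byParts_le_of_holder hst hk hk' hks hk0 hf hK (by linarith) hfK hC hD).trans ?_
    calc K * ((1 + γ) * Q + γ * (2 + γ) * Q / (α' - (γ + ζ))) * (t - s) ^ (α' - (γ + ζ))
        = K * (t - s) ^ (α' - α) * (1 + γ + γ * (2 + γ) / (α' - (γ + ζ))) * Q *
            (t - s) ^ (α - γ - ζ) := by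
          rw [show α' - (γ + ζ) = (α' - α) + (α - γ - ζ) by ring, Real.rpow_add hts]; ring
      _ ≤ _ := by gcongr

theorem psi1_pos {α γ τ t s : ℝ} (hst : s < t) (htτ : t < τ) : 0 < psi1 α γ τ t s := by
  have h1 : 0 < |t - s| := abs_pos.2 (sub_pos.2 hst).ne'
  have h2 : 0 < |τ - t| := abs_pos.2 (sub_pos.2 htτ).ne'
  exact lt_min (by positivity) (by positivity)

theorem psi12_pos {α γ η ζ τ τ' t s : ℝ} (hst : s < t) (htτ' : t < τ') (hττ' : τ' < τ) :
    0 < psi12 α γ η ζ τ τ' t s := by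
  have h1 : 0 < |t - s| := abs_pos.2 (sub_pos.2 hst).ne'
  have h2 : 0 < |τ' - t| := abs_pos.2 (sub_pos.2 htτ').ne'
  have h3 : 0 < |τ - τ'| := abs_pos.2 (sub_pos.2 hττ').ne'
  exact mul_pos (by positivity) (lt_min (by positivity) (by positivity))

theorem enorm_div_ofReal_le {F : Type*} [NormedAddCommGroup F] {x : F} {a c : ℝ} (ha : 0 < a)
    (h : ‖x‖ ≤ c * a) : ‖x‖ₑ / ENNReal.ofReal a ≤ ENNReal.ofReal c := by
  refine ENNReal.div_le_of_le_mul ?_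
  rw [← ENNReal.ofReal_mul' ha.le, ← ofReal_norm]
  exact ENNReal.ofReal_le_ofReal h

/-- The norm of the pathwise first level is controlled by the `α'`-Hölder constant of the path. -/
theorem exists_volterraNorm_pathLevel_le {T α α' γ η ζ : ℝ} (hT : 0 < T) (hγ : 0 < γ)
    (hα : γ < α) (hαα' : α < α') (hη0 : 0 ≤ η) (hη1 : η ≤ 1) (hζ0 : 0 ≤ ζ) (hζα : ζ ≤ α - γ)
    (hζη : ζ ≤ η) :
    ∃ C : ℝ, 0 ≤ C ∧ ∀ (f : ℝ → E) (K : ℝ), Continuous f → 0 ≤ K →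
      (∀ s ∈ Icc 0 T, ∀ t ∈ Icc 0 T, ‖f t - f s‖ ≤ K * |t - s| ^ α') →
      volterraNorm T α γ η ζ (pathLevel γ f) ≤ ENNReal.ofReal (C * K) := by
  have hd : 0 < α' - (γ + ζ) := by linarith
  have hd' : 0 < α' - γ := by linarith
  set C₁ := T ^ (α' - α) * (1 + γ / (α - γ)) with hC₁
  set C₂ := T ^ (α' - α) * (1 + γ + γ * (2 + γ) / (α' - (γ + ζ))) with hC₂
  have hC₁0 : 0 ≤ C₁ := by
    have := sub_pos.2 hα
    positivity
  have hC₂0 : 0 ≤ C₂ := by positivity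
  refine ⟨C₁ + C₂, by positivity, fun f K hf hK hfK ↦ ?_⟩
  rw [volterraNorm, add_mul, ENNReal.ofReal_add (by positivity) (by positivity)]
  refine add_le_add (iSup₂_le fun x hx ↦ ?_) (iSup₂_le fun x hx ↦ ?_)
  · have h01 : x 0 < x 1 := hx.2 (by decide)
    have h12 : x 1 < x 2 := hx.2 (by decide)
    refine enorm_div_ofReal_le (psi1_pos h01 h12) ?_
    have hM : ∀ r ∈ Icc (x 0) (x 1),
        ‖f (x 1) - f r‖ ≤ K * T ^ (α' - α) * (x 1 - r) ^ α := fun r hr ↦ by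
      have hr0 : 0 ≤ x 1 - r := sub_nonneg.2 hr.2
      have hrT : x 1 - r ≤ T := by linarith [(hx.1 0).1, (hx.1 1).2, hr.1]
      refine (hfK r ⟨(hx.1 0).1.trans hr.1, hr.2.trans (hx.1 1).2⟩ (x 1) (hx.1 1)).trans ?_
      rw [abs_of_nonneg hr0, mul_assoc]
      refine mul_le_mul_of_nonneg_left ?_ hK
      rw [show α' = (α' - α) + α by ring, Real.rpow_add_of_nonneg hr0 (by linarith)
        (by linarith), add_sub_cancel_right]
      gcongr
    refine (norm_pathLevel_le hγ hα (by positivity) hf hM h01 h12).trans_eq ?_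
    rw [hC₁]; ring
  · have h01 : x 0 < x 1 := hx.2 (by decide)
    have h12 : x 1 < x 2 := hx.2 (by decide)
    have h23 : x 2 < x 3 := hx.2 (by decide)
    refine enorm_div_ofReal_le (psi12_pos h01 h12 h23) ?_
    have hM : ∀ r ∈ Icc (x 0) (x 1), ‖f (x 1) - f r‖ ≤ K * (x 1 - r) ^ α' := fun r hr ↦ by
      have := hfK r ⟨(hx.1 0).1.trans hr.1, hr.2.trans (hx.1 1).2⟩ (x 1) (hx.1 1)
      rwa [abs_of_nonneg (sub_nonneg.2 hr.2)] at this
    refine (norm_pathLevel_sub_le hγ hα hαα' hη0 hη1 hζ0 hζα hζη hK hf hM (hx.1 0).1 h01 h12 h23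
      (hx.1 3).2).trans_eq ?_
    rw [hC₂]; ring

end PathBounds

end Volterra

namespace Volterra

/-! ### Hölder continuity of Brownian paths -/

/-- Chaining: passing from ⌊x2ⁿ⌋/2ⁿ to the next level moves by at most one cell, so the
approximations of g(x) have a geometric tail. At the scale 2^{-n-1} < |t-s| ≤ 2^{-n} the
approximations of s and t coincide or are neighbours. Two tails and one middle step give 2/(1-ρ) +
1; the division by ρ pays for ρ^{n+1} ≤ |t-s|^α. -/
theorem norm_sub_le_of_dyadic {F : Type*} [NormedAddCommGroup F] {g : ℝ → F} {K α : ℝ}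
    (hα : 0 < α) (hK : 0 ≤ K) (hg : ContinuousOn g (Icc 0 1))
    (h : ∀ n k : ℕ, k < 2 ^ n →
      ‖g (((k + 1 : ℕ) : ℝ) / 2 ^ n) - g ((k : ℝ) / 2 ^ n)‖ ≤ K * ((2 : ℝ)⁻¹ ^ α) ^ n) :
    ∀ s ∈ Icc (0 : ℝ) 1, ∀ t ∈ Icc (0 : ℝ) 1, ‖g t - g s‖ ≤
      (2 / (1 - (2 : ℝ)⁻¹ ^ α) + 1) / (2 : ℝ)⁻¹ ^ α * K * |t - s| ^ α := by
  set ρ : ℝ := (2 : ℝ)⁻¹ ^ α with hρ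
  have hρ0 : 0 < ρ := by positivity
  have hρ1 : ρ < 1 := Real.rpow_lt_one (by norm_num) (by norm_num) hα
  have h1ρ : 0 < 1 - ρ := sub_pos.2 hρ1
  have hfl : ∀ x ∈ Icc (0 : ℝ) 1, ∀ n : ℕ, ⌊x * 2 ^ n⌋₊ ≤ 2 ^ n := fun x hx n ↦ by
    refine Nat.floor_le_of_le ?_
    push_cast
    have : (0 : ℝ) < 2 ^ n := by positivity
    nlinarith [hx.2]
  have hstep : ∀ (n k l : ℕ), k ≤ l → l ≤ k + 1 → l ≤ 2 ^ n →
      ‖g ((l : ℝ) / 2 ^ n) - g ((k : ℝ) / 2 ^ n)‖ ≤ K * ρ ^ n := fun n k l h1 h2 h3 ↦ by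
    rcases eq_or_lt_of_le h1 with rfl | h4
    · rw [sub_self, norm_zero]
      positivity
    · obtain rfl : l = k + 1 := by omega
      exact h n k h3
  have htail : ∀ x ∈ Icc (0 : ℝ) 1, ∀ n : ℕ,
      ‖g ((⌊x * 2 ^ n⌋₊ : ℝ) / 2 ^ n) - g x‖ ≤ K * ρ ^ n / (1 - ρ) := fun x hx n ↦ by
    rw [← dist_eq_norm]
    refine dist_le_of_le_geometric_of_tendsto ρ K
      (f := fun n : ℕ ↦ g ((⌊x * 2 ^ n⌋₊ : ℝ) / 2 ^ n)) hρ1 (fun n ↦ ?_) ?_ n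
    · have e : (⌊x * 2 ^ n⌋₊ : ℝ) / 2 ^ n = ((2 * ⌊x * 2 ^ n⌋₊ : ℕ) : ℝ) / 2 ^ (n + 1) := by
        push_cast
        field_simp
        ring
      rw [dist_comm, dist_eq_norm, e]
      have hx2 : 0 ≤ x * 2 ^ n := mul_nonneg hx.1 (by positivity)
      have hx3 : 0 ≤ x * 2 ^ (n + 1) := mul_nonneg hx.1 (by positivity)
      refine (hstep (n + 1) _ _ ?_ ?_ (hfl x hx _)).trans ?_
      · refine Nat.le_floor ?_
        push_cast
        rw [pow_succ]
        linarith [Nat.floor_le hx2]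
      · refine Nat.lt_succ_iff.1 ((Nat.floor_lt hx3).2 ?_)
        push_cast
        rw [pow_succ]
        linarith [Nat.lt_floor_add_one (x * 2 ^ n)]
      · rw [pow_succ]
        nlinarith [mul_nonneg hK (pow_nonneg hρ0.le n)]
    · have h1 : Tendsto (fun n : ℕ ↦ (⌊x * 2 ^ n⌋₊ : ℝ) / 2 ^ n) atTop (𝓝 x) :=
        (tendsto_nat_floor_mul_div_atTop hx.1).comp (tendsto_pow_atTop_atTop_of_one_lt one_lt_two)
      refine (hg x hx).tendsto.comp (tendsto_nhdsWithin_iff.2 ⟨h1, Eventually.of_forall fun n ↦ ?_⟩)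
      refine ⟨by positivity, div_le_one_of_le₀ ?_ (by positivity)⟩
      exact_mod_cast hfl x hx n
  have main : ∀ s ∈ Icc (0 : ℝ) 1, ∀ t ∈ Icc (0 : ℝ) 1, s < t → ‖g t - g s‖ ≤
      (2 / (1 - ρ) + 1) / ρ * K * |t - s| ^ α := fun s hs t ht hst ↦ by
    have hts : 0 < t - s := sub_pos.2 hst
    obtain ⟨n, hn1, hn2⟩ := exists_nat_pow_near_of_lt_one hts (by linarith [hs.1, ht.2])
      (show (0 : ℝ) < 2⁻¹ by norm_num) (by norm_num)
    have h1 : ‖g ((⌊t * 2 ^ n⌋₊ : ℝ) / 2 ^ n) - g ((⌊s * 2 ^ n⌋₊ : ℝ) / 2 ^ n)‖ ≤ K * ρ ^ n := by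
      refine hstep n _ _ (Nat.floor_le_floor (by gcongr)) ?_ (hfl t ht n)
      rw [← Nat.floor_add_one (mul_nonneg hs.1 (by positivity))]
      refine Nat.floor_le_floor ?_
      have h3 : (0 : ℝ) < 2 ^ n := by positivity
      have h4 : (t - s) * 2 ^ n ≤ 1 := by
        rw [inv_pow] at hn2
        calc (t - s) * 2 ^ n ≤ (2 ^ n)⁻¹ * 2 ^ n := by gcongr
          _ = 1 := inv_mul_cancel₀ h3.ne'
      linarith
    have h2 := htail s hs n
    have h3 := htail t ht n
    have h4 : ‖g t - g s‖ ≤ K * ρ ^ n / (1 - ρ) + K * ρ ^ n + K * ρ ^ n / (1 - ρ) := by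
      rw [norm_sub_rev] at h3
      calc ‖g t - g s‖ = ‖(g t - g ((⌊t * 2 ^ n⌋₊ : ℝ) / 2 ^ n)) +
            (g ((⌊t * 2 ^ n⌋₊ : ℝ) / 2 ^ n) - g ((⌊s * 2 ^ n⌋₊ : ℝ) / 2 ^ n)) +
            (g ((⌊s * 2 ^ n⌋₊ : ℝ) / 2 ^ n) - g s)‖ := by congr 1; abel
        _ ≤ _ := (norm_add₃_le).trans (add_le_add_three h3 h1 h2)
    have h5 : ρ ^ n ≤ |t - s| ^ α / ρ := by
      rw [le_div_iff₀ hρ0, ← pow_succ, abs_of_pos hts, hρ, ← Real.rpow_natCast, ← Real.rpow_mul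
        (by norm_num), mul_comm, Real.rpow_mul (by norm_num), Real.rpow_natCast]
      exact Real.rpow_le_rpow (by positivity) hn1.le hα.le
    calc ‖g t - g s‖ ≤ (2 / (1 - ρ) + 1) * K * ρ ^ n := h4.trans_eq (by ring)
      _ ≤ (2 / (1 - ρ) + 1) * K * (|t - s| ^ α / ρ) := by gcongr
      _ = _ := by ring
  intro s hs t ht
  rcases lt_trichotomy s t with hst | rfl | hst
  · exact main s hs t ht hst
  · rw [sub_self, norm_zero]
    positivity
  · rw [norm_sub_rev, abs_sub_comm]
    exact main t ht s hs hst

/-! ### Gaussian moments and Brownian increments -/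

variable {Ω : Type*} [MeasurableSpace Ω] {P : Measure Ω}

theorem lintegral_enorm_rpow_of_map_eq_gaussianReal {X : Ω → ℝ} (hX : AEMeasurable X P) {v : ℝ}
    (hv : 0 ≤ v) (h : P.map X = gaussianReal 0 v.toNNReal) (q : ℝ) (hq : 0 ≤ q) :
    ∫⁻ ω, ‖X ω‖ₑ ^ q ∂P =
      ENNReal.ofReal (v ^ (q / 2)) * ∫⁻ x, ‖x‖ₑ ^ q ∂(gaussianReal 0 1) := by
  have hm : Measurable fun x : ℝ ↦ ‖x‖ₑ ^ q := by fun_prop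
  have e : gaussianReal 0 v.toNNReal = (gaussianReal 0 1).map (fun x ↦ √v * x) := by
    rw [gaussianReal_map_const_mul, mul_zero, mul_one]
    congr 1
    ext
    simp [hv]
  calc ∫⁻ ω, ‖X ω‖ₑ ^ q ∂P = ∫⁻ x, ‖x‖ₑ ^ q ∂(P.map X) :=
        (lintegral_map' hm.aemeasurable hX).symm
    _ = ∫⁻ x, ‖√v * x‖ₑ ^ q ∂(gaussianReal 0 1) := by
        rw [h, e, lintegral_map hm (by fun_prop)]
    _ = ∫⁻ x, ENNReal.ofReal (v ^ (q / 2)) * ‖x‖ₑ ^ q ∂(gaussianReal 0 1) := by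
        refine lintegral_congr fun x ↦ ?_
        rw [enorm_mul, ENNReal.mul_rpow_of_nonneg _ _ hq, Real.enorm_of_nonneg (Real.sqrt_nonneg v),
          ENNReal.ofReal_rpow_of_nonneg (Real.sqrt_nonneg v) hq, Real.sqrt_eq_rpow,
          ← Real.rpow_mul hv, one_div, inv_mul_eq_div]
    _ = _ := lintegral_const_mul _ hm

theorem lintegral_enorm_rpow_gaussianReal_lt_top (q : ℝ) (hq : 0 < q) :
    ∫⁻ x, ‖x‖ₑ ^ q ∂(gaussianReal 0 1) < ∞ := by
  have := lintegral_rpow_enorm_lt_top_of_eLpNorm_lt_top (p := ENNReal.ofReal q)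
    (by simpa using hq) ENNReal.ofReal_ne_top
    (memLp_id_gaussianReal' (μ := 0) (v := 1) _ ENNReal.ofReal_ne_top).2
  simpa [ENNReal.toReal_ofReal hq.le] using this

variable {T : ℝ} {m : ℕ} {W : Icc (0 : ℝ) T → Ω → EuclideanSpace ℝ (Fin m)}

namespace IsBrownianMotion

theorem memLp (hW : IsBrownianMotion W P) (i : Fin m) (t : Icc (0 : ℝ) T) :
    MemLp (fun ω ↦ W t ω i) 2 P := ((hW.gaussian i).hasGaussianLaw_eval t).memLp_two

theorem integral_mul [IsProbabilityMeasure P] (hW : IsBrownianMotion W P) (i : Fin m)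
    (s t : Icc (0 : ℝ) T) : ∫ ω, W s ω i * W t ω i ∂P = min (s : ℝ) t := by
  have h := hW.covariance i s t
  rw [covariance_eq_sub (hW.memLp i s) (hW.memLp i t), hW.centered, zero_mul, sub_zero] at h
  exact h

theorem map_sub [IsProbabilityMeasure P] (hW : IsBrownianMotion W P) (i : Fin m)
    (s t : Icc (0 : ℝ) T) :
    P.map (fun ω ↦ W t ω i - W s ω i) = gaussianReal 0 |(t : ℝ) - s|.toNNReal := by
  have hs := hW.memLp i s
  have ht := hW.memLp i t
  rw [(hW.gaussian i).hasGaussianLaw_fun_sub.map_eq_gaussianReal]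
  congr 1
  · rw [integral_sub (ht.integrable (by norm_num)) (hs.integrable (by norm_num)), hW.centered,
      hW.centered, sub_zero]
  · congr 1
    have h := variance_sub ht hs
    rw [← covariance_self ht.1.aemeasurable, ← covariance_self hs.1.aemeasurable, hW.covariance,
      hW.covariance, hW.covariance, min_self, min_self] at h
    refine h.trans ?_
    rcases le_total (t : ℝ) s with hst | hst
    · rw [min_eq_left hst, abs_of_nonpos (by linarith)]; ring
    · rw [min_eq_right hst, abs_of_nonneg (by linarith)]; ring

end IsBrownianMotion

end Volterra

namespace Volterra

/-! ### From increment moments to a random Hölder constant -/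

variable {Ω : Type*} [MeasurableSpace Ω] {P : Measure Ω}

/-- A family of real random variables, `2ⁿ` of them for each `n`, with `q`-th moments at most
`c (T 2⁻ⁿ)^{q/2}` is dominated by `K 2^{-nα}`, `α < 1/2`, for some `K` with finite `q`-th
moment, provided that `q (1/2 - α) ≥ 2`. -/
theorem exists_memLp_dyadic_bound {Y : ℕ → ℕ → Ω → ℝ} (hY : ∀ n k, AEMeasurable (Y n k) P)
    {T α q : ℝ} {M : ℝ≥0∞} (hT : 0 < T) (hq : 0 < q) (hqα : 2 ≤ (1 / 2 - α) * q) (hM : M < ∞)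
    (h : ∀ n k, k < 2 ^ n →
      ∫⁻ ω, ‖Y n k ω‖ₑ ^ q ∂P ≤ ENNReal.ofReal ((T * (2 : ℝ)⁻¹ ^ n) ^ (q / 2)) * M) :
    ∃ K : Ω → ℝ, (∀ ω, 0 ≤ K ω) ∧ MemLp K (ENNReal.ofReal q) P ∧
      ∀ᵐ ω ∂P, ∀ n k, k < 2 ^ n → ‖Y n k ω‖ ≤ K ω * ((2 : ℝ)⁻¹ ^ α) ^ n := by
  set ρ : ℝ := (2 : ℝ)⁻¹ ^ α with hρ
  have hρ0 : 0 < ρ := by positivity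
  -- The sum S of the q-th powers of all normalised variables dominates each of them, so S^{1/q}
  -- serves as K.
  set F : ℕ → ℕ → Ω → ℝ≥0∞ :=
    fun n k ω ↦ (ENNReal.ofReal ((ρ ^ n)⁻¹) * ‖Y n k ω‖ₑ) ^ q with hF
  have hFm : ∀ n k, AEMeasurable (F n k) P := fun n k ↦
    ((hY n k).enorm.const_mul _).pow_const q
  set S : Ω → ℝ≥0∞ := fun ω ↦ ∑' n, ∑ k ∈ Finset.range (2 ^ n), F n k ω with hS
  have hSm : AEMeasurable S P :=
    AEMeasurable.tsum fun n ↦ Finset.aemeasurable_fun_sum _ fun k _ ↦ hFm n k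
  -- Ratio of the series for the expectation of S: 2ⁿ terms at level n, the normalisation ρ^{-nq},
  -- and the moment factor 2^{-nq/2}.
  set r : ℝ := 2 * (ρ ^ q)⁻¹ * (2 : ℝ)⁻¹ ^ (q / 2) with hr
  have hr0 : 0 ≤ r := by positivity
  have hr1 : r < 1 := by
    have e : r = (2 : ℝ)⁻¹ ^ (-1 + -(α * q) + q / 2) := by
      rw [Real.rpow_add (by norm_num), Real.rpow_add (by norm_num), Real.rpow_neg_one, inv_inv,
        Real.rpow_neg (by norm_num), Real.rpow_mul (by norm_num)]
    rw [e]
    exact Real.rpow_lt_one (by norm_num) (by norm_num) (by linarith)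
  have hFn : ∀ n, ∑ k ∈ Finset.range (2 ^ n), ∫⁻ ω, F n k ω ∂P ≤
      ENNReal.ofReal (T ^ (q / 2) * r ^ n) * M := fun n ↦ by
    have h1 : ∀ k ∈ Finset.range (2 ^ n), ∫⁻ ω, F n k ω ∂P ≤
        ENNReal.ofReal (((ρ ^ n)⁻¹) ^ q * (T * (2 : ℝ)⁻¹ ^ n) ^ (q / 2)) * M := fun k hk ↦ by
      simp only [hF, ENNReal.mul_rpow_of_nonneg _ _ hq.le]
      rw [lintegral_const_mul'' _ ((hY n k).enorm.pow_const q), ENNReal.ofReal_mul (by positivity),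
        ENNReal.ofReal_rpow_of_nonneg (by positivity) hq.le, mul_assoc]
      gcongr
      exact h n k (Finset.mem_range.1 hk)
    refine (Finset.sum_le_sum h1).trans_eq ?_
    rw [Finset.sum_const, Finset.card_range, nsmul_eq_mul, ← mul_assoc]
    congr 1
    rw [show ((2 ^ n : ℕ) : ℝ≥0∞) = ENNReal.ofReal (2 ^ n) by
      rw [ENNReal.ofReal_pow (by norm_num)]; simp, ← ENNReal.ofReal_mul (by positivity)]
    congr 1
    rw [Real.mul_rpow hT.le (by positivity), Real.inv_rpow (by positivity),
      ← Real.rpow_pow_comm hρ0.le, ← Real.rpow_pow_comm (by norm_num), hr, mul_pow, mul_pow, inv_pow]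
    ring
  have hSint : ∫⁻ ω, S ω ∂P < ∞ := by
    rw [lintegral_tsum fun n ↦ Finset.aemeasurable_fun_sum _ fun k _ ↦ hFm n k]
    simp_rw [lintegral_finsetSum' _ fun k _ ↦ hFm _ k]
    refine (ENNReal.tsum_le_tsum hFn).trans_lt ?_
    rw [ENNReal.tsum_mul_right]
    refine ENNReal.mul_lt_top ?_ hM
    exact ((summable_geometric_of_lt_one hr0 hr1).mul_left _).tsum_ofReal_lt_top
  have hStop : ∀ᵐ ω ∂P, S ω < ∞ := ae_lt_top' hSm hSint.ne
  refine ⟨fun ω ↦ (S ω ^ q⁻¹).toReal, fun ω ↦ ENNReal.toReal_nonneg, ⟨?_, ?_⟩, ?_⟩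
  · exact (hSm.pow_const _).ennreal_toReal.aestronglyMeasurable
  · rw [eLpNorm_lt_top_iff_lintegral_rpow_enorm_lt_top (by simpa using hq) ENNReal.ofReal_ne_top,
      ENNReal.toReal_ofReal hq.le]
    refine (lintegral_mono fun ω ↦ ?_).trans_lt hSint
    rw [Real.enorm_of_nonneg ENNReal.toReal_nonneg]
    calc _ ≤ (S ω ^ q⁻¹) ^ q := ENNReal.rpow_le_rpow ENNReal.ofReal_toReal_le hq.le
      _ = S ω := ENNReal.rpow_inv_rpow hq.ne' _
  · filter_upwards [hStop] with ω hω n k hk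
    have h1 : F n k ω ≤ S ω := by
      refine le_trans ?_ (ENNReal.le_tsum n)
      exact Finset.single_le_sum (f := fun k ↦ F n k ω) (fun _ _ ↦ zero_le) (Finset.mem_range.2 hk)
    rw [hF, ← ENNReal.le_rpow_inv_iff hq] at h1
    have h2 := ENNReal.toReal_mono (ENNReal.rpow_ne_top_of_nonneg (by positivity) hω.ne) h1
    rw [ENNReal.toReal_mul, ENNReal.toReal_ofReal (by positivity), toReal_enorm,
      inv_mul_le_iff₀ (by positivity)] at h2
    linarith

variable {T : ℝ} {m : ℕ} {W : Icc (0 : ℝ) T → Ω → EuclideanSpace ℝ (Fin m)}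

/-- The paths of `W`, extended to the real line by constants. -/
noncomputable def extendedPath (hT : 0 ≤ T) (W : Icc (0 : ℝ) T → Ω → EuclideanSpace ℝ (Fin m))
    (ω : Ω) : ℝ → EuclideanSpace ℝ (Fin m) := IccExtend hT fun t ↦ W t ω

theorem IsBrownianMotion.exists_coord_holder [IsProbabilityMeasure P] (hW : IsBrownianMotion W P)
    (hT : 0 < T) {α q : ℝ} (hα0 : 0 < α) (hα : α < 1 / 2) (hq : 0 < q) (i : Fin m) :
    ∃ K : Ω → ℝ, (∀ ω, 0 ≤ K ω) ∧ MemLp K (ENNReal.ofReal q) P ∧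
      ∀ᵐ ω ∂P, ∀ s ∈ Icc 0 T, ∀ t ∈ Icc 0 T,
        ‖extendedPath hT.le W ω t i - extendedPath hT.le W ω s i‖ ≤ K ω * |t - s| ^ α := by
  have hα' : 0 < 1 / 2 - α := by linarith
  -- Chaining requires a large moment order; on a probability space the result descends to the order
  -- q. Time is rescaled to [0,1], which accounts for T^{-α} below.
  set q₀ := max q (2 / (1 / 2 - α)) with hq₀
  have hq₀0 : 0 < q₀ := hq.trans_le (le_max_left _ _)
  obtain ⟨K, hK0, hKq, hK⟩ := exists_memLp_dyadic_bound (P := P) (T := T) (α := α) (q := q₀)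
    (Y := fun n k ω ↦ extendedPath hT.le W ω (T * (((k + 1 : ℕ) : ℝ) / 2 ^ n)) i -
      extendedPath hT.le W ω (T * ((k : ℝ) / 2 ^ n)) i)
    (M := ∫⁻ x, ‖x‖ₑ ^ q₀ ∂(gaussianReal 0 1))
    (fun n k ↦ ((hW.gaussian i).aemeasurable _).sub ((hW.gaussian i).aemeasurable _)) hT hq₀0
    (by
      have := le_max_right q (2 / (1 / 2 - α))
      rwa [div_le_iff₀ hα', mul_comm] at this)
    (lintegral_enorm_rpow_gaussianReal_lt_top q₀ hq₀0) (fun n k hk ↦ by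
      have h1 : T * ((k : ℝ) / 2 ^ n) ∈ Icc 0 T := by
        refine ⟨by positivity, mul_le_of_le_one_right hT.le (div_le_one_of_le₀ ?_ (by positivity))⟩
        exact_mod_cast hk.le
      have h2 : T * (((k + 1 : ℕ) : ℝ) / 2 ^ n) ∈ Icc 0 T := by
        refine ⟨by positivity, mul_le_of_le_one_right hT.le (div_le_one_of_le₀ ?_ (by positivity))⟩
        exact_mod_cast hk
      have h3 := hW.map_sub i ⟨_, h1⟩ ⟨_, h2⟩
      have h4 : |T * (((k + 1 : ℕ) : ℝ) / 2 ^ n) - T * ((k : ℝ) / 2 ^ n)| =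
          T * (2 : ℝ)⁻¹ ^ n := by
        rw [← mul_sub, ← sub_div, Nat.cast_add, Nat.cast_one, add_sub_cancel_left,
          abs_of_nonneg (by positivity), one_div, inv_pow]
      rw [h4] at h3
      simp only [extendedPath, IccExtend_of_mem _ _ h1, IccExtend_of_mem _ _ h2]
      exact (lintegral_enorm_rpow_of_map_eq_gaussianReal
        (((hW.gaussian i).aemeasurable _).sub ((hW.gaussian i).aemeasurable _))
        (by positivity) h3 q₀ hq₀0.le).le)
  set C := (2 / (1 - (2 : ℝ)⁻¹ ^ α) + 1) / (2 : ℝ)⁻¹ ^ α with hC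
  have hC0 : 0 ≤ C := by
    have : (2 : ℝ)⁻¹ ^ α < 1 := Real.rpow_lt_one (by norm_num) (by norm_num) hα0
    have := sub_pos.2 this
    positivity
  refine ⟨fun ω ↦ C * T ^ (-α) * K ω, fun ω ↦ mul_nonneg (by positivity) (hK0 ω),
    (hKq.mono_exponent (ENNReal.ofReal_le_ofReal (le_max_left _ _))).const_mul _, ?_⟩
  filter_upwards [hK, hW.continuous_paths] with ω hω hcont s hs t ht
  have hc : Continuous fun u ↦ extendedPath hT.le W ω (T * u) i :=
    (continuous_apply i).comp ((PiLp.continuous_ofLp 2 _).comp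
      (hcont.Icc_extend'.comp (continuous_const.mul continuous_id)))
  have hmem : ∀ u ∈ Icc 0 T, u / T ∈ Icc (0 : ℝ) 1 := fun u hu ↦
    ⟨div_nonneg hu.1 hT.le, div_le_one_of_le₀ hu.2 hT.le⟩
  have h := norm_sub_le_of_dyadic (g := fun u ↦ extendedPath hT.le W ω (T * u) i) hα0 (hK0 ω)
    hc.continuousOn hω (s / T) (hmem s hs) (t / T) (hmem t ht)
  simp only [mul_div_cancel₀ _ hT.ne'] at h
  refine h.trans_eq ?_
  rw [← sub_div, abs_div, abs_of_pos hT, Real.div_rpow (abs_nonneg _) hT.le, Real.rpow_neg hT.le]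
  ring

theorem norm_euclidean_le_sum (v : EuclideanSpace ℝ (Fin m)) : ‖v‖ ≤ ∑ i, ‖v i‖ := by
  rw [EuclideanSpace.norm_eq]
  refine Real.sqrt_le_iff.2 ⟨Finset.sum_nonneg fun i _ ↦ norm_nonneg _, ?_⟩
  exact Finset.sum_sq_le_sq_sum_of_nonneg fun i _ ↦ norm_nonneg _

/-- Brownian paths are `α`-Hölder for `α < 1/2`, with a Hölder constant having moments of any
given order. -/
theorem IsBrownianMotion.exists_holder [IsProbabilityMeasure P] (hW : IsBrownianMotion W P)
    (hT : 0 < T) {α q : ℝ} (hα0 : 0 < α) (hα : α < 1 / 2) (hq : 0 < q) :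
    ∃ K : Ω → ℝ, (∀ ω, 0 ≤ K ω) ∧ MemLp K (ENNReal.ofReal q) P ∧
      ∀ᵐ ω ∂P, ∀ s ∈ Icc 0 T, ∀ t ∈ Icc 0 T,
        ‖extendedPath hT.le W ω t - extendedPath hT.le W ω s‖ ≤ K ω * |t - s| ^ α := by
  choose K hK0 hKq hK using fun i ↦ hW.exists_coord_holder hT hα0 hα hq i
  refine ⟨fun ω ↦ ∑ i, K i ω, fun ω ↦ Finset.sum_nonneg fun i _ ↦ hK0 i ω,
    memLp_finsetSum _ fun i _ ↦ hKq i, ?_⟩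
  filter_upwards [ae_all_iff.2 hK] with ω hω s hs t ht
  refine (norm_euclidean_le_sum _).trans ?_
  rw [Finset.sum_mul]
  exact Finset.sum_le_sum fun i _ ↦ hω i s hs t ht

end Volterra

namespace Volterra

/-! ### Uniqueness of Wiener integrals -/

section Isometry

variable {Ω Ω' ι : Type*} [MeasurableSpace Ω] [MeasurableSpace Ω'] {P : Measure Ω}
  {Q : Measure Ω'}

theorem memLp_finsupp_sum {X : ι → Ω → ℝ} (hX : ∀ i, MemLp (X i) 2 P) (c : ι →₀ ℝ) :
    MemLp (fun ω ↦ c.sum fun i a ↦ a * X i ω) 2 P :=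
  memLp_finsetSum _ fun i _ ↦ (hX i).const_mul (c i)

theorem integral_finsupp_sum_sq {X : ι → Ω → ℝ} (hX : ∀ i, MemLp (X i) 2 P) (c : ι →₀ ℝ) :
    ∫ ω, (c.sum fun i a ↦ a * X i ω) ^ 2 ∂P =
      ∑ i ∈ c.support, ∑ j ∈ c.support, c i * c j * ∫ ω, X i ω * X j ω ∂P := by
  have hint : ∀ i j, Integrable (fun ω ↦ c i * c j * (X i ω * X j ω)) P :=
    fun i j ↦ ((hX i).integrable_mul (hX j)).const_mul _
  have e : ∀ ω, (c.sum fun i a ↦ a * X i ω) ^ 2 =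
      ∑ i ∈ c.support, ∑ j ∈ c.support, c i * c j * (X i ω * X j ω) := fun ω ↦ by
    rw [Finsupp.sum, sq, Finset.sum_mul_sum]
    exact Finset.sum_congr rfl fun i _ ↦ Finset.sum_congr rfl fun j _ ↦ by ring
  simp_rw [e]
  rw [integral_finsetSum _ fun i _ ↦ integrable_finsetSum _ fun j _ ↦ hint i j]
  refine Finset.sum_congr rfl fun i _ ↦ ?_
  rw [integral_finsetSum _ fun j _ ↦ hint i j]
  exact Finset.sum_congr rfl fun j _ ↦ integral_const_mul _ _

/-- Two families of `L²` functions with the same Gram matrix: corresponding linear combinations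
have the same norm. -/
theorem eLpNorm_finsupp_sum_eq {X : ι → Ω → ℝ} {Y : ι → Ω' → ℝ} (hX : ∀ i, MemLp (X i) 2 P)
    (hY : ∀ i, MemLp (Y i) 2 Q)
    (h : ∀ i j, ∫ ω, X i ω * X j ω ∂P = ∫ ω, Y i ω * Y j ω ∂Q) (c : ι →₀ ℝ) :
    eLpNorm (fun ω ↦ c.sum fun i a ↦ a * X i ω) 2 P =
      eLpNorm (fun ω ↦ c.sum fun i a ↦ a * Y i ω) 2 Q := by
  rw [(memLp_finsupp_sum hX c).eLpNorm_eq_integral_rpow_norm two_ne_zero ENNReal.ofNat_ne_top,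
    (memLp_finsupp_sum hY c).eLpNorm_eq_integral_rpow_norm two_ne_zero ENNReal.ofNat_ne_top]
  simp only [ENNReal.toReal_ofNat, Real.rpow_ofNat, Real.norm_eq_abs, sq_abs]
  rw [integral_finsupp_sum_sq hX, integral_finsupp_sum_sq hY]
  simp only [h]

end Isometry

variable {Ω : Type*} [MeasurableSpace Ω] {P : Measure Ω} {T : ℝ}

theorem stepFunction_sub (c d : Icc (0 : ℝ) T →₀ ℝ) (r : ℝ) :
    stepFunction (c - d) r = stepFunction c r - stepFunction d r :=
  Finsupp.sum_sub_index fun _ _ _ ↦ sub_mul _ _ _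

theorem stepIntegral_sub {Ω : Type*} (X : Icc (0 : ℝ) T → Ω → ℝ) (c d : Icc (0 : ℝ) T →₀ ℝ) (ω : Ω) :
    stepIntegral X (c - d) ω = stepIntegral X c ω - stepIntegral X d ω :=
  Finsupp.sum_sub_index fun _ _ _ ↦ sub_mul _ _ _

theorem memLp_indicator_Icc (t : Icc (0 : ℝ) T) :
    MemLp (fun r ↦ (Icc (0 : ℝ) t).indicator (1 : ℝ → ℝ) r) 2 (volume.restrict (Icc 0 T)) :=
  memLp_indicator_const 2 measurableSet_Icc 1 (Or.inr (measure_ne_top _ _))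

variable {m : ℕ} {W : Icc (0 : ℝ) T → Ω → EuclideanSpace ℝ (Fin m)} [IsProbabilityMeasure P]

/-- The Itô isometry: min(s,t) is also the L² inner product of the indicators of [0,s] and [0,t], so
the two families have equal Gram matrices. -/
theorem IsBrownianMotion.eLpNorm_stepIntegral (hW : IsBrownianMotion W P) (i : Fin m)
    (c : Icc (0 : ℝ) T →₀ ℝ) :
    eLpNorm (stepIntegral (fun t ω ↦ W t ω i) c) 2 P =
      eLpNorm (stepFunction c) 2 (volume.restrict (Icc 0 T)) := by
  refine eLpNorm_finsupp_sum_eq (hW.memLp i) memLp_indicator_Icc (fun s t ↦ ?_) c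
  have e : ∀ r, (Icc (0 : ℝ) s).indicator (1 : ℝ → ℝ) r * (Icc (0 : ℝ) t).indicator 1 r =
      (Icc (0 : ℝ) (min s t)).indicator 1 r := fun r ↦ by
    rw [← inter_indicator_mul, Icc_inter_Icc, sup_idem]
    simp [indicator]
  have hsub : Icc (0 : ℝ) (min s t) ⊆ Icc 0 T :=
    Icc_subset_Icc_right ((min_le_left _ _).trans s.2.2)
  simp_rw [hW.integral_mul i s t, e]
  rw [integral_indicator_one measurableSet_Icc, Measure.real,
    Measure.restrict_apply measurableSet_Icc, inter_eq_self_of_subset_left hsub, Real.volume_Icc,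
    sub_zero, ENNReal.toReal_ofReal (le_min s.2.1 t.2.1)]

/-- Up to two vanishing errors, Y - Y' is the integral of the difference of the approximating step
functions. By the isometry its norm is that of a difference of two sequences with the same limit h.
-/
theorem IsBrownianMotion.wienerIntegral_unique (hW : IsBrownianMotion W P) (i : Fin m)
    {h : ℝ → ℝ} {Y Y' : Ω → ℝ} (hY : IsWienerIntegral (fun t ω ↦ W t ω i) P h Y)
    (hY' : IsWienerIntegral (fun t ω ↦ W t ω i) P h Y') : Y =ᵐ[P] Y' := by
  obtain ⟨hh, hYm, c, hc, hcY⟩ := hY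
  obtain ⟨-, hYm', c', hc', hcY'⟩ := hY'
  have hS : ∀ c, AEStronglyMeasurable (stepIntegral (fun t ω ↦ W t ω i) c) P :=
    fun c ↦ (memLp_finsupp_sum (hW.memLp i) c).1
  have hF : ∀ c : Icc (0 : ℝ) T →₀ ℝ,
      AEStronglyMeasurable (stepFunction c) (volume.restrict (Icc 0 T)) :=
    fun c ↦ (memLp_finsupp_sum memLp_indicator_Icc c).1
  have key : ∀ n, eLpNorm (Y - Y') 2 P ≤
      eLpNorm (fun ω ↦ stepIntegral (fun t ω ↦ W t ω i) (c n) ω - Y ω) 2 P +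
      eLpNorm (fun ω ↦ stepIntegral (fun t ω ↦ W t ω i) (c' n) ω - Y' ω) 2 P +
      (eLpNorm (fun r ↦ stepFunction (c n) r - h r) 2 (volume.restrict (Icc 0 T)) +
        eLpNorm (fun r ↦ stepFunction (c' n) r - h r) 2 (volume.restrict (Icc 0 T))) := fun n ↦ by
    have e1 : Y - Y' = ((fun ω ↦ stepIntegral (fun t ω ↦ W t ω i) (c' n) ω - Y' ω) -
        (fun ω ↦ stepIntegral (fun t ω ↦ W t ω i) (c n) ω - Y ω)) +
        stepIntegral (fun t ω ↦ W t ω i) (c n - c' n) := by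
      funext ω
      simp only [Pi.add_apply, Pi.sub_apply, stepIntegral_sub]
      ring
    have e2 : stepFunction (c n - c' n) = (fun r ↦ stepFunction (c n) r - h r) -
        fun r ↦ stepFunction (c' n) r - h r := by
      funext r
      simp only [Pi.sub_apply, stepFunction_sub]
      ring
    have h1 := eLpNorm_sub_le (p := 2) ((hF (c n)).sub hh.1) ((hF (c' n)).sub hh.1) one_le_two
    have h2 := eLpNorm_sub_le (p := 2) ((hS (c' n)).sub hYm'.1) ((hS (c n)).sub hYm.1) one_le_two
    have h3 := eLpNorm_add_le (p := 2) (((hS (c' n)).sub hYm'.1).sub ((hS (c n)).sub hYm.1))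
      (hS (c n - c' n)) one_le_two
    rw [hW.eLpNorm_stepIntegral, e2] at h3
    rw [e1]
    refine h3.trans (add_le_add (h2.trans_eq (add_comm _ _)) h1)
  have hlim := (hcY.add hcY').add (hc.add hc')
  simp only [add_zero] at hlim
  have h0 : eLpNorm (Y - Y') 2 P = 0 := le_antisymm (ge_of_tendsto' hlim key) zero_le
  rw [eLpNorm_eq_zero_iff (hYm.1.sub hYm'.1) two_ne_zero] at h0
  filter_upwards [h0] with ω hω
  exact sub_eq_zero.1 hω

end Volterra

namespace Volterra

/-! ### The pathwise first level is a Wiener integral -/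

section RiemannSums

/-- Each cell contributes at most M times the increase of k there, and these increases telescope, so
the bound does not deteriorate with the number of cells. -/
theorem norm_riemannSum_sub_byParts_le {E : Type*} [NormedAddCommGroup E] [NormedSpace ℝ E]
    [CompleteSpace E] {k k' : ℝ → ℝ} {f : ℝ → E} {M : ℝ} {r : ℕ → ℝ} (hr : Monotone r)
    (hf : Continuous f) (n : ℕ) (hk : ∀ u ∈ Icc (r 0) (r n), HasDerivAt k (k' u) u)
    (hk' : ContinuousOn k' (Icc (r 0) (r n))) (hk0 : ∀ u ∈ Icc (r 0) (r n), 0 ≤ k' u)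
    (hM : ∀ j < n, ∀ u ∈ Icc (r j) (r (j + 1)), ‖f (r (j + 1)) - f u‖ ≤ M) :
    ‖∑ j ∈ Finset.range n, k (r j) • (f (r (j + 1)) - f (r j)) - byParts k k' f (r 0) (r n)‖ ≤
      M * (k (r n) - k (r 0)) := by
  induction n with
  | zero => simp [byParts]
  | succ n ih =>
    have h0 : r 0 ≤ r n := hr (Nat.zero_le n)
    have h1 : r n ≤ r (n + 1) := hr n.le_succ
    have hs1 : Icc (r 0) (r n) ⊆ Icc (r 0) (r (n + 1)) := Icc_subset_Icc_right h1
    have hs2 : Icc (r n) (r (n + 1)) ⊆ Icc (r 0) (r (n + 1)) := Icc_subset_Icc_left h0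
    have ih' := ih (fun u hu ↦ hk u (hs1 hu)) (hk'.mono hs1) (fun u hu ↦ hk0 u (hs1 hu))
      fun j hj ↦ hM j (by omega)
    have hl := norm_smul_sub_sub_byParts_le h1 (fun u hu ↦ hk u (hs2 hu)) (hk'.mono hs2)
      (fun u hu ↦ hk0 u (hs2 hu)) hf (hM n n.lt_succ_self)
    rw [Finset.sum_range_succ, ← byParts_add h0 h1 hk' hf, add_sub_add_comm]
    refine (norm_add_le _ _).trans ((add_le_add ih' hl).trans_eq ?_)
    ring

theorem abs_riemannSum_indicator_sub_le {k : ℝ → ℝ} {ε x : ℝ} {r : ℕ → ℝ} (hr : Monotone r)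
    (n : ℕ) (hε : ∀ j < n, ∀ u ∈ Icc (r j) (r (j + 1)), |k (r j) - k u| ≤ ε) :
    |∑ j ∈ Finset.range n, k (r j) * (Ioc (r j) (r (j + 1))).indicator 1 x -
      (Ioc (r 0) (r n)).indicator k x| ≤ ε * (Ioc (r 0) (r n)).indicator 1 x := by
  induction n with
  | zero => simp
  | succ n ih =>
    have h0 : r 0 ≤ r n := hr (Nat.zero_le n)
    have h1 : r n ≤ r (n + 1) := hr n.le_succ
    have hd : Disjoint (Ioc (r 0) (r n)) (Ioc (r n) (r (n + 1))) :=
      disjoint_left.2 fun y hy hy' ↦ hy'.1.not_ge hy.2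
    have ih' := ih fun j hj ↦ hε j (by omega)
    rw [Finset.sum_range_succ, ← Ioc_union_Ioc_eq_Ioc h0 h1, indicator_union_of_disjoint hd,
      indicator_union_of_disjoint hd, mul_add, add_sub_add_comm]
    refine (abs_add_le _ _).trans (add_le_add ih' ?_)
    by_cases hx : x ∈ Ioc (r n) (r (n + 1))
    · simpa [hx] using hε n n.lt_succ_self x (Ioc_subset_Icc_self hx)
    · simp [hx]

theorem indicator_Icc_sub_indicator_Icc {a b x : ℝ} (hab : a ≤ b) (hx : 0 ≤ x) :
    (Icc 0 b).indicator (1 : ℝ → ℝ) x - (Icc 0 a).indicator 1 x = (Ioc a b).indicator 1 x := by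
  by_cases h1 : x ≤ a
  · simp [indicator, hx, h1, h1.trans hab]
  · by_cases h2 : x ≤ b <;> simp [indicator, h1, h2, hx, not_le.1 h1]

end RiemannSums

section RiemannStep

variable {T : ℝ}

/-- The step function `∑_{j<n} k(r_j) 1_{(r_j, r_{j+1}]}`. -/
noncomputable def riemannStep (hT : 0 ≤ T) (k : ℝ → ℝ) (r : ℕ → ℝ) (n : ℕ) :
    Icc (0 : ℝ) T →₀ ℝ :=
  ∑ j ∈ Finset.range n, (Finsupp.single (projIcc 0 T hT (r (j + 1))) (k (r j)) -
    Finsupp.single (projIcc 0 T hT (r j)) (k (r j)))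

/-- Evaluated with X either the indicators or the Brownian values, so that one coefficient family
yields both the step function and its integral. -/
theorem linearCombination_riemannStep (hT : 0 ≤ T) (k : ℝ → ℝ) (r : ℕ → ℝ) (n : ℕ)
    (X : Icc (0 : ℝ) T → ℝ) :
    ((riemannStep hT k r n).sum fun t a ↦ a * X t) = ∑ j ∈ Finset.range n,
      k (r j) * (X (projIcc 0 T hT (r (j + 1))) - X (projIcc 0 T hT (r j))) := by
  change Finsupp.linearCombination ℝ X (riemannStep hT k r n) = _
  rw [riemannStep, map_sum]
  refine Finset.sum_congr rfl fun j _ ↦ ?_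
  rw [map_sub, Finsupp.linearCombination_single, Finsupp.linearCombination_single, mul_sub]
  rfl

theorem stepFunction_riemannStep (hT : 0 ≤ T) (k : ℝ → ℝ) {r : ℕ → ℝ} (hr : Monotone r) (n : ℕ)
    (hr0 : 0 ≤ r 0) (hrT : r n ≤ T) {x : ℝ} (hx : 0 ≤ x) :
    stepFunction (riemannStep hT k r n) x =
      ∑ j ∈ Finset.range n, k (r j) * (Ioc (r j) (r (j + 1))).indicator 1 x := by
  rw [stepFunction, linearCombination_riemannStep hT k r n
    fun t ↦ (Icc (0 : ℝ) t).indicator (1 : ℝ → ℝ) x]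
  refine Finset.sum_congr rfl fun j hj ↦ ?_
  have hmem : ∀ l ≤ n, r l ∈ Icc 0 T := fun l hl ↦
    ⟨hr0.trans (hr (Nat.zero_le l)), (hr hl).trans hrT⟩
  have hj' := Finset.mem_range.1 hj
  rw [projIcc_of_mem hT (hmem j hj'.le), projIcc_of_mem hT (hmem (j + 1) hj'),
    indicator_Icc_sub_indicator_Icc (hr j.le_succ) hx]

end RiemannStep

theorem abs_sub_rpow_neg_sub_le {γ τ t a u : ℝ} (hγ : 0 < γ) (hau : a ≤ u) (hut : u ≤ t)
    (htτ : t < τ) :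
    |(τ - a) ^ (-γ) - (τ - u) ^ (-γ)| ≤ (1 + γ) * (τ - t) ^ (-γ - 1) * (u - a) := by
  have h1 : 0 < τ - u := by linarith
  have h2 := rpow_neg_sub_rpow_neg_le (b := τ - a) h1 (by linarith) hγ.le zero_le_one le_rfl
  have h3 : (τ - a) ^ (-γ) ≤ (τ - u) ^ (-γ) :=
    Real.rpow_le_rpow_of_nonpos h1 (by linarith) (by linarith)
  have h4 : (τ - u) ^ (-γ - 1) ≤ (τ - t) ^ (-γ - 1) :=
    Real.rpow_le_rpow_of_nonpos (by linarith) (by linarith) (by linarith)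
  rw [abs_sub_comm, abs_of_nonneg (sub_nonneg.2 h3)]
  rw [Real.rpow_one, show τ - a - (τ - u) = u - a by ring] at h2
  have h5 : 0 ≤ u - a := sub_nonneg.2 hau
  calc _ ≤ _ := h2
    _ ≤ (1 + γ) * (u - a) * (τ - t) ^ (-γ - 1) := by gcongr
    _ = _ := by ring

theorem kernel_of_mem {γ τ t s r : ℝ} (hr : r ∈ Icc s t) : kernel γ τ t s r = (τ - r) ^ (-γ) :=
  indicator_of_mem hr _

theorem kernel_of_notMem {γ τ t s r : ℝ} (hr : r ∉ Icc s t) : kernel γ τ t s r = 0 :=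
  indicator_of_notMem hr _

theorem memLp_kernel {T γ τ t s : ℝ} (hγ : 0 < γ) (htτ : t < τ) :
    MemLp (kernel γ τ t s) 2 (volume.restrict (Icc 0 T)) := by
  refine memLp_of_bounded (a := 0) (b := (τ - t) ^ (-γ)) (ae_of_all _ fun r ↦ ?_)
    (Measurable.indicator (by fun_prop) measurableSet_Icc).aestronglyMeasurable 2
  have h0 : 0 ≤ (τ - t) ^ (-γ) := Real.rpow_nonneg (by linarith) _
  by_cases hr : r ∈ Icc s t
  · rw [indicator_of_mem hr]
    exact ⟨Real.rpow_nonneg (by linarith [hr.2]) _,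
      Real.rpow_le_rpow_of_nonpos (by linarith) (by linarith [hr.2]) (by linarith)⟩
  · rw [indicator_of_notMem hr]
    exact ⟨le_rfl, h0⟩

variable {Ω : Type*} [MeasurableSpace Ω] {P : Measure Ω} [IsProbabilityMeasure P] {T : ℝ} {m : ℕ}
  {W : Icc (0 : ℝ) T → Ω → EuclideanSpace ℝ (Fin m)}

theorem IsBrownianMotion.isWienerIntegral_pathLevel (hW : IsBrownianMotion W P) (hT : 0 < T)
    {γ τ t s : ℝ} (hγ : 0 < γ) (hs : 0 ≤ s) (hst : s < t) (htτ : t < τ) (hτ : τ ≤ T)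
    (i : Fin m) :
    IsWienerIntegral (fun t ω ↦ W t ω i) P (kernel γ τ t s)
      (fun ω ↦ pathLevel γ (extendedPath hT.le W ω) τ t s i) := by
  -- Any exponent in (0,1/2) would do: a positive power of the mesh and a square-integrable constant
  -- suffice.
  obtain ⟨K, hK0, hK2, hK⟩ := hW.exists_holder hT (α := 1 / 4) (q := 2) (by norm_num)
    (by norm_num) (by norm_num)
  rw [show ENNReal.ofReal 2 = 2 by simp] at hK2
  set k : ℝ → ℝ := fun r ↦ (τ - r) ^ (-γ) with hkdef
  set δ : ℕ → ℝ := fun n ↦ (t - s) / (n + 1 : ℕ) with hδ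
  have hδ0 : ∀ n, 0 ≤ δ n := fun n ↦ div_nonneg (sub_nonneg.2 hst.le) (Nat.cast_nonneg _)
  have hδlim : Tendsto δ atTop (𝓝 0) :=
    (tendsto_const_div_atTop_nhds_zero_nat (t - s)).comp (tendsto_add_atTop_nat 1)
  set r : ℕ → ℕ → ℝ := fun n j ↦ s + j * δ n with hr
  have hrm : ∀ n, Monotone (r n) := fun n a b hab ↦ by
    have := hδ0 n
    simp only [hr]
    gcongr
  have hr0 : ∀ n, r n 0 = s := fun n ↦ by simp [hr]
  have hrn : ∀ n, r n (n + 1) = t := fun n ↦ by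
    simp only [hr, hδ]
    rw [mul_div_cancel₀ _ (by positivity), add_sub_cancel]
  have hrs : ∀ n j, r n (j + 1) = r n j + δ n := fun n j ↦ by
    simp only [hr]
    push_cast
    ring
  have hle : ∀ n, ∀ j < n + 1, s ≤ r n j ∧ r n (j + 1) ≤ t := fun n j hj ↦
    ⟨(hr0 n).symm.le.trans (hrm n (Nat.zero_le j)), (hrm n hj).trans (hrn n).le⟩
  have hSmem : ∀ c, MemLp (stepIntegral (fun t ω ↦ W t ω i) c) 2 P :=
    fun c ↦ memLp_finsupp_sum (hW.memLp i) c
  set c : ℕ → Icc (0 : ℝ) T →₀ ℝ := fun n ↦ riemannStep hT.le k (r n) (n + 1) with hc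
  set Y : Ω → ℝ := fun ω ↦ pathLevel γ (extendedPath hT.le W ω) τ t s i with hY
  set B : ℝ := k t - k s with hB
  have hB0 : 0 ≤ B := sub_nonneg.2
    (Real.rpow_le_rpow_of_nonpos (by linarith) (by linarith) (by linarith))
  have hbound : ∀ᵐ ω ∂P, ∀ n, ‖stepIntegral (fun t ω ↦ W t ω i) (c n) ω - Y ω‖ ≤
      δ n ^ (1 / 4 : ℝ) * B * ‖K ω‖ := by
    filter_upwards [hK, hW.continuous_paths] with ω hω hcont n
    have hf : Continuous (extendedPath hT.le W ω) := hcont.Icc_extend'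
    have h1 := norm_riemannSum_sub_byParts_le (k := k)
      (k' := fun r ↦ γ * (τ - r) ^ (-γ - 1)) (M := K ω * δ n ^ (1 / 4 : ℝ)) (hrm n) hf (n + 1)
      (by
        rw [hr0, hrn]
        exact fun u hu ↦ hasDerivAt_sub_rpow_neg (hu.2.trans_lt htτ))
      (by
        rw [hr0, hrn]
        exact continuousOn_mul_sub_rpow _ htτ)
      (by
        rw [hr0, hrn]
        exact fun u hu ↦ mul_nonneg hγ.le (Real.rpow_nonneg (by linarith [hu.2]) _))
      (fun j hj u hu ↦ by
        have h2 := hle n j hj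
        have h3 := hω u ⟨by linarith [hu.1], by linarith [hu.2]⟩ (r n (j + 1))
          ⟨by linarith [hu.1, hu.2], by linarith⟩
        refine h3.trans (mul_le_mul_of_nonneg_left ?_ (hK0 ω))
        rw [abs_of_nonneg (sub_nonneg.2 hu.2)]
        exact Real.rpow_le_rpow (sub_nonneg.2 hu.2) (by linarith [hrs n j, hu.1]) (by norm_num))
    rw [hr0, hrn] at h1
    have h4 := (PiLp.norm_apply_le _ i).trans h1
    have h5 : stepIntegral (fun t ω ↦ W t ω i) (c n) ω = (∑ j ∈ Finset.range (n + 1), k (r n j) •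
        (extendedPath hT.le W ω (r n (j + 1)) - extendedPath hT.le W ω (r n j))) i := by
      rw [stepIntegral, hc, linearCombination_riemannStep hT.le k (r n) (n + 1) fun t ↦ W t ω i]
      simp [extendedPath, IccExtend]
    rw [h5, Real.norm_of_nonneg (hK0 ω)]
    refine (le_of_eq ?_).trans (h4.trans_eq (by rw [hB]; ring))
    simp only [hY, pathLevel, PiLp.sub_apply, hkdef]
  have hδ4 : Tendsto (fun n ↦ δ n ^ (1 / 4 : ℝ) * B) atTop (𝓝 0) := by
    have := (hδlim.rpow_const (p := 1 / 4) (Or.inr (by norm_num))).mul_const B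
    simpa using this
  -- Measurability of the pathwise integral comes from its being an almost sure limit of step
  -- integrals; square integrability then follows since its distance to one of them is dominated by
  -- K.
  have hYm : AEStronglyMeasurable Y P := by
    refine aestronglyMeasurable_of_tendsto_ae atTop (fun n ↦ (hSmem (c n)).1) ?_
    filter_upwards [hbound] with ω hω
    refine tendsto_iff_norm_sub_tendsto_zero.2
      (squeeze_zero (fun _ ↦ norm_nonneg _) hω ?_)
    simpa using hδ4.mul_const ‖K ω‖
  have hYL : MemLp Y 2 P := by
    have h1 : MemLp (fun ω ↦ stepIntegral (fun t ω ↦ W t ω i) (c 0) ω - Y ω) 2 P :=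
      hK2.of_le_mul ((hSmem (c 0)).1.sub hYm) (hbound.mono fun ω hω ↦ hω 0)
    have h2 := (hSmem (c 0)).sub h1
    convert h2 using 1
    funext ω
    simp
  refine ⟨memLp_kernel hγ htτ, hYL, c, ?_, ?_⟩
  · have hb : ∀ n, eLpNorm (fun x ↦ stepFunction (c n) x - kernel γ τ t s x) 2
        (volume.restrict (Icc 0 T)) ≤ (volume.restrict (Icc 0 T)) univ ^ (2 : ℝ≥0∞).toReal⁻¹ *
          ENNReal.ofReal ((1 + γ) * (τ - t) ^ (-γ - 1) * δ n) := fun n ↦ by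
      refine eLpNorm_le_of_ae_bound ?_
      -- The kernel lives on [s,t] but the step functions on (s,t]; the point s is negligible.
      have hne : ∀ᵐ x ∂(volume.restrict (Icc 0 T)), x ≠ s :=
        ae_restrict_of_ae (Measure.ae_ne volume s)
      filter_upwards [hne, ae_restrict_mem measurableSet_Icc] with x hxs hx
      have hε0 : 0 ≤ (1 + γ) * (τ - t) ^ (-γ - 1) * δ n :=
        mul_nonneg (mul_nonneg (by linarith) (Real.rpow_nonneg (by linarith) _)) (hδ0 n)
      have h1 := abs_riemannSum_indicator_sub_le (k := k) (x := x)
        (ε := (1 + γ) * (τ - t) ^ (-γ - 1) * δ n) (hrm n) (n + 1) fun j hj u hu ↦ by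
          refine (abs_sub_rpow_neg_sub_le hγ hu.1 (hu.2.trans (hle n j hj).2) htτ).trans ?_
          refine mul_le_mul_of_nonneg_left (by linarith [hrs n j, hu.2]) ?_
          exact mul_nonneg (by linarith) (Real.rpow_nonneg (by linarith) _)
      rw [← stepFunction_riemannStep hT.le k (hrm n) (n + 1) (by rwa [hr0])
        (by rw [hrn]; linarith) hx.1, hr0, hrn] at h1
      have h2 : kernel γ τ t s x = (Ioc s t).indicator k x := by
        by_cases hxt : x ∈ Icc s t
        · rw [kernel_of_mem hxt,
            indicator_of_mem (show x ∈ Ioc s t from ⟨lt_of_le_of_ne hxt.1 hxs.symm, hxt.2⟩)]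
        · rw [kernel_of_notMem hxt,
            indicator_of_notMem fun h ↦ hxt (Ioc_subset_Icc_self h)]
      rw [h2, Real.norm_eq_abs]
      refine h1.trans (mul_le_of_le_one_right hε0 ?_)
      exact indicator_le_self' (fun _ _ ↦ zero_le_one) x
    refine tendsto_of_tendsto_of_tendsto_of_le_of_le tendsto_const_nhds ?_ (fun _ ↦ zero_le) hb
    have h1 : Tendsto (fun n ↦ ENNReal.ofReal ((1 + γ) * (τ - t) ^ (-γ - 1) * δ n)) atTop
        (𝓝 0) := by
      have := ENNReal.tendsto_ofReal (hδlim.const_mul ((1 + γ) * (τ - t) ^ (-γ - 1)))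
      simpa using this
    have h2 := ENNReal.Tendsto.const_mul
      (a := (volume.restrict (Icc 0 T)) univ ^ (2 : ℝ≥0∞).toReal⁻¹) h1
      (Or.inr (ENNReal.rpow_ne_top_of_nonneg (by positivity) (measure_ne_top _ _)))
    simpa only [mul_zero] using h2
  · have hb : ∀ n, eLpNorm (fun ω ↦ stepIntegral (fun t ω ↦ W t ω i) (c n) ω - Y ω) 2 P ≤
        ENNReal.ofReal (δ n ^ (1 / 4 : ℝ) * B) * eLpNorm K 2 P := fun n ↦
      eLpNorm_le_mul_eLpNorm_of_ae_le_mul (hbound.mono fun ω hω ↦ hω n) 2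
    refine tendsto_of_tendsto_of_tendsto_of_le_of_le tendsto_const_nhds ?_ (fun _ ↦ zero_le) hb
    have h2 := ENNReal.Tendsto.mul_const (b := eLpNorm K 2 P) (ENNReal.tendsto_ofReal hδ4)
      (Or.inr hK2.2.ne)
    simpa only [ENNReal.ofReal_zero, zero_mul] using h2

end Volterra

namespace Volterra

/-! ### Indistinguishability of versions and measurability of the norm -/

theorem vec_mem_simplex_three {T s t τ : ℝ} (hs : 0 ≤ s) (hst : s < t) (htτ : t < τ)
    (hτ : τ ≤ T) : ![s, t, τ] ∈ simplex T 3 := by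
  refine ⟨fun i ↦ ?_, ?_⟩
  · fin_cases i <;> simp <;> constructor <;> linarith
  · refine Fin.strictMono_iff_lt_succ.2 fun i ↦ ?_
    fin_cases i <;> simpa

section Norms

variable {E : Type*} [NormedAddCommGroup E]

theorem volterraNorm_congr {T α γ η ζ : ℝ} {z z' : ℝ → ℝ → ℝ → E}
    (h : ∀ x ∈ simplex T 3, z (x 2) (x 1) (x 0) = z' (x 2) (x 1) (x 0)) :
    volterraNorm T α γ η ζ z = volterraNorm T α γ η ζ z' := by
  rw [volterraNorm, volterraNorm]
  congr 1
  · exact iSup_congr fun x ↦ iSup_congr fun hx ↦ by rw [h x hx]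
  · refine iSup_congr fun x ↦ iSup_congr fun hx ↦ ?_
    have h01 : x 0 < x 1 := hx.2 (by decide)
    have h12 : x 1 < x 2 := hx.2 (by decide)
    have h23 : x 2 < x 3 := hx.2 (by decide)
    have e1 := h _ (vec_mem_simplex_three (hx.1 0).1 h01 h12 (hx.1 2).2)
    have e2 := h _ (vec_mem_simplex_three (hx.1 0).1 h01 (h12.trans h23) (hx.1 3).2)
    simp only [Matrix.cons_val] at e1 e2
    rw [e1, e2]

theorem iSup_dense {X : Type*} [TopologicalSpace X] {D : Set X} (hD : Dense D) {g : X → ℝ≥0∞}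
    (hg : Continuous g) : ⨆ x, g x = ⨆ x ∈ D, g x := by
  refine le_antisymm (iSup_le fun x ↦ ?_) (iSup₂_le fun x _ ↦ le_iSup g x)
  have h : closure D ⊆ {x | g x ≤ ⨆ y ∈ D, g y} :=
    closure_minimal (fun y hy ↦ le_iSup₂ (f := fun y (_ : y ∈ D) ↦ g y) y hy)
      (isClosed_le hg continuous_const)
  exact h (hD x)

/-- For almost every ω, continuity reduces the uncountable supremum to one over a fixed countable
dense subset. -/
theorem aemeasurable_iSup_of_continuous {Ω X : Type*} [MeasurableSpace Ω] {P : Measure Ω}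
    [TopologicalSpace X] [SecondCountableTopology X] {S : Set X} {g : Ω → X → ℝ≥0∞}
    (hm : ∀ x ∈ S, AEMeasurable (fun ω ↦ g ω x) P)
    (hc : ∀ᵐ ω ∂P, ContinuousOn (g ω) S) : AEMeasurable (fun ω ↦ ⨆ x ∈ S, g ω x) P := by
  obtain ⟨D, hDc, hD⟩ := TopologicalSpace.exists_countable_dense S
  refine (AEMeasurable.biSup (f := fun (x : S) ω ↦ g ω x) D hDc fun x _ ↦ hm x x.2).congr ?_
  filter_upwards [hc] with ω hω
  exact (iSup_dense hD (continuousOn_iff_continuous_domRestrict.1 hω)).symm.trans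
    (iSup_subtype'' S (g ω))

theorem continuousOn_enorm_div_ofReal {X : Type*} [TopologicalSpace X] {S : Set X} {g : X → E}
    {a : X → ℝ} (hg : ContinuousOn g S) (ha : ContinuousOn a S) (ha0 : ∀ x ∈ S, 0 < a x) :
    ContinuousOn (fun x ↦ ‖g x‖ₑ / ENNReal.ofReal (a x)) S := by
  have h : ContinuousOn (fun x ↦ ENNReal.ofReal (‖g x‖ / a x)) S :=
    ENNReal.continuous_ofReal.comp_continuousOn (hg.norm.div ha fun x hx ↦ (ha0 x hx).ne')
  refine h.congr fun x hx ↦ ?_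
  simp only [ENNReal.ofReal_div_of_pos (ha0 x hx), ofReal_norm]

theorem continuousOn_psi1 (T α γ : ℝ) :
    ContinuousOn (fun x : Fin 3 → ℝ ↦ psi1 α γ (x 2) (x 1) (x 0)) (simplex T 3) := by
  have hc : ∀ i j : Fin 3, i < j → ∀ p : ℝ,
      ContinuousOn (fun x : Fin 3 → ℝ ↦ |x j - x i| ^ p) (simplex T 3) := fun i j hij p ↦
    ContinuousOn.rpow_const (by fun_prop)
      fun x hx ↦ Or.inl (abs_pos.2 (sub_pos.2 (hx.2 hij)).ne').ne'
  exact ((hc 1 2 (by decide) _).mul (hc 0 1 (by decide) _)).inf (hc 0 1 (by decide) _)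

theorem continuousOn_psi12 (T α γ η ζ : ℝ) :
    ContinuousOn (fun x : Fin 4 → ℝ ↦ psi12 α γ η ζ (x 3) (x 2) (x 1) (x 0)) (simplex T 4) := by
  have hc : ∀ i j : Fin 4, i < j → ∀ p : ℝ,
      ContinuousOn (fun x : Fin 4 → ℝ ↦ |x j - x i| ^ p) (simplex T 4) := fun i j hij p ↦
    ContinuousOn.rpow_const (by fun_prop)
      fun x hx ↦ Or.inl (abs_pos.2 (sub_pos.2 (hx.2 hij)).ne').ne'
  exact ((hc 2 3 (by decide) _).mul (hc 1 2 (by decide) _)).mul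
    (((hc 1 2 (by decide) _).mul (hc 0 1 (by decide) _)).inf (hc 0 1 (by decide) _))

theorem aemeasurable_volterraNorm {Ω : Type*} [MeasurableSpace Ω] {P : Measure Ω}
    [MeasurableSpace E] [BorelSpace E] [SecondCountableTopology E] {T α γ η ζ : ℝ}
    {z : Ω → ℝ → ℝ → ℝ → E}
    (hm : ∀ x ∈ simplex T 3, AEMeasurable (fun ω ↦ z ω (x 2) (x 1) (x 0)) P)
    (hc : ∀ᵐ ω ∂P,
      ContinuousOn (fun x : Fin 3 → ℝ ↦ z ω (x 2) (x 1) (x 0)) (simplex T 3)) :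
    AEMeasurable (fun ω ↦ volterraNorm T α γ η ζ (z ω)) P := by
  have hface : ∀ j : Fin 4, 2 ≤ j → ∀ x ∈ simplex T 4, ![x 0, x 1, x j] ∈ simplex T 3 :=
    fun j hj x hx ↦ vec_mem_simplex_three (hx.1 0).1 (hx.2 (by decide))
      (hx.2 (lt_of_lt_of_le (by decide) hj)) (hx.1 j).2
  refine AEMeasurable.add ?_ ?_
  · refine aemeasurable_iSup_of_continuous (fun x hx ↦ (hm x hx).enorm.div_const _) ?_
    filter_upwards [hc] with ω hω
    exact continuousOn_enorm_div_ofReal hω (continuousOn_psi1 T α γ)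
      fun x hx ↦ psi1_pos (hx.2 (by decide)) (hx.2 (by decide))
  · refine aemeasurable_iSup_of_continuous (fun x hx ↦ ?_) ?_
    · exact ((hm _ (hface 3 (by decide) x hx)).sub
        (hm _ (hface 2 (by decide) x hx))).enorm.div_const _
    · filter_upwards [hc] with ω hω
      have hj : ∀ j : Fin 4, 2 ≤ j →
          ContinuousOn (fun x : Fin 4 → ℝ ↦ z ω (x j) (x 1) (x 0)) (simplex T 4) :=
        fun j hj ↦ hω.comp (f := fun x : Fin 4 → ℝ ↦ ![x 0, x 1, x j])
          (by fun_prop) (hface j hj)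
      exact continuousOn_enorm_div_ofReal ((hj 3 (by decide)).sub (hj 2 (by decide)))
        (continuousOn_psi12 T α γ η ζ)
        fun x hx ↦ psi12_pos (hx.2 (by decide)) (hx.2 (by decide)) (hx.2 (by decide))

end Norms

/-! ### Continuous versions of the first level -/

variable {Ω : Type*} [MeasurableSpace Ω] {P : Measure Ω} {T : ℝ} {m : ℕ}
  {W : Icc (0 : ℝ) T → Ω → EuclideanSpace ℝ (Fin m)} {γ : ℝ}

theorem IsFirstLevel.aemeasurable {z : Ω → ℝ → ℝ → ℝ → EuclideanSpace ℝ (Fin m)}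
    (hz : IsFirstLevel W P γ z) (x : Fin 3 → ℝ) (hx : x ∈ simplex T 3) :
    AEMeasurable (fun ω ↦ z ω (x 2) (x 1) (x 0)) P :=
  (WithLp.measurable_toLp 2 _).comp_aemeasurable
    (aemeasurable_pi_lambda (fun ω i ↦ z ω (x 2) (x 1) (x 0) i)
      fun i ↦ (hz.isWienerIntegral x hx i).2.1.1.aemeasurable)

variable [IsProbabilityMeasure P]

theorem IsBrownianMotion.isFirstLevel_pathLevel (hW : IsBrownianMotion W P) (hT : 0 < T)
    (hγ : 0 < γ) : IsFirstLevel W P γ fun ω ↦ pathLevel γ (extendedPath hT.le W ω) where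
  isWienerIntegral x hx i := hW.isWienerIntegral_pathLevel hT hγ (hx.1 0).1 (hx.2 (by decide))
    (hx.2 (by decide)) (hx.1 2).2 i
  continuous := by
    filter_upwards [hW.continuous_paths] with ω hω
    exact continuousOn_pathLevel hω.Icc_extend'

/-- Any two continuous versions of the first level are indistinguishable. -/
theorem IsFirstLevel.indistinguishable (hW : IsBrownianMotion W P)
    {z z' : Ω → ℝ → ℝ → ℝ → EuclideanSpace ℝ (Fin m)} (hz : IsFirstLevel W P γ z)
    (hz' : IsFirstLevel W P γ z') :
    ∀ᵐ ω ∂P, ∀ x ∈ simplex T 3, z ω (x 2) (x 1) (x 0) = z' ω (x 2) (x 1) (x 0) := by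
  obtain ⟨D, hDc, hD⟩ := TopologicalSpace.exists_countable_dense (simplex T 3)
  have h : ∀ᵐ ω ∂P, ∀ x ∈ D, z ω (x.1 2) (x.1 1) (x.1 0) = z' ω (x.1 2) (x.1 1) (x.1 0) := by
    rw [ae_ball_iff hDc]
    intro x _
    have hi : ∀ᵐ ω ∂P, ∀ i, z ω (x.1 2) (x.1 1) (x.1 0) i = z' ω (x.1 2) (x.1 1) (x.1 0) i :=
      ae_all_iff.2 fun i ↦ hW.wienerIntegral_unique i (hz.isWienerIntegral x x.2 i)
        (hz'.isWienerIntegral x x.2 i)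
    filter_upwards [hi] with ω hω
    exact PiLp.ext hω
  filter_upwards [h, hz.continuous, hz'.continuous] with ω hω h1 h2 x hx
  exact congrFun (Continuous.ext_on hD (continuousOn_iff_continuous_domRestrict.1 h1)
    (continuousOn_iff_continuous_domRestrict.1 h2) hω) ⟨x, hx⟩

/-- The norm of a continuous version of the first level is dominated by a random variable having
moments of any given order. -/
theorem IsFirstLevel.exists_volterraNorm_le (hW : IsBrownianMotion W P) (hT : 0 < T)
    {z : Ω → ℝ → ℝ → ℝ → EuclideanSpace ℝ (Fin m)} (hz : IsFirstLevel W P γ z) {α η ζ q : ℝ}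
    (hγ : 0 < γ) (hγα : γ < α) (hα : α < 1 / 2) (hη0 : 0 ≤ η) (hη1 : η ≤ 1) (hζ0 : 0 ≤ ζ)
    (hζα : ζ ≤ α - γ) (hζη : ζ ≤ η) (hq : 0 < q) :
    ∃ K : Ω → ℝ, (∀ ω, 0 ≤ K ω) ∧ MemLp K (ENNReal.ofReal q) P ∧
      ∀ᵐ ω ∂P, volterraNorm T α γ η ζ (z ω) ≤ ENNReal.ofReal (K ω) := by
  -- The spare Hölder regularity between α and 1/2 covers the extreme case ζ = α - γ.
  obtain ⟨α', hαα', hα'⟩ := exists_between hα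
  obtain ⟨K, hK0, hKq, hK⟩ := hW.exists_holder hT (by linarith) hα' hq
  obtain ⟨C, hC0, hC⟩ := exists_volterraNorm_pathLevel_le (E := EuclideanSpace ℝ (Fin m)) hT hγ
    hγα hαα' hη0 hη1 hζ0 hζα hζη
  refine ⟨fun ω ↦ C * K ω, fun ω ↦ mul_nonneg hC0 (hK0 ω), hKq.const_mul C, ?_⟩
  filter_upwards [hK, hW.continuous_paths,
    hz.indistinguishable hW (hW.isFirstLevel_pathLevel hT hγ)] with ω h1 h2 h3
  rw [volterraNorm_congr h3]
  exact hC _ _ h2.Icc_extend' (hK0 ω) h1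

end Volterra

theorem mainTheorem10 {Ω : Type*} [MeasurableSpace Ω] (P : Measure Ω) [IsProbabilityMeasure P]
    (m : ℕ) (T : ℝ) (hT : 0 < T) (W : Icc (0 : ℝ) T → Ω → EuclideanSpace ℝ (Fin m))
    (hW : Volterra.IsBrownianMotion W P) (γ : ℝ) (hγ0 : 0 < γ) (hγ : γ < 1 / 2) :
    (∃ z, Volterra.IsFirstLevel W P γ z) ∧
    ∀ z, Volterra.IsFirstLevel W P γ z →
      (∀ α η ζ : ℝ, 0 < α → α < 1 / 2 → η ∈ Icc (0 : ℝ) 1 → ζ ∈ Icc (0 : ℝ) 1 →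
        0 < α - γ → ζ ≤ min (α - γ) η → 1 - α < η →
        (∀ᵐ ω ∂P, z ω ∈ Volterra.volterraSpace T α γ η ζ) ∧
        (AEMeasurable (fun ω ↦ Volterra.volterraNorm T α γ η ζ (z ω)) P ∧
          ∀ p : ℝ, 1 ≤ p →
            ∫⁻ ω, Volterra.volterraNorm T α γ η ζ (z ω) ^ (2 * p) ∂P < ∞)) ∧
      (∀ᵐ ω ∂P, ∀ x ∈ Volterra.simplex T 4,
        Volterra.delta (z ω (x 3)) (x 2) (x 1) (x 0) = 0) := by
  refine ⟨⟨_, hW.isFirstLevel_pathLevel hT hγ0⟩, fun z hz ↦ ⟨?_, ?_⟩⟩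
  · intro α η ζ _ hα hη hζ hαγ hζm _
    have hbound : ∀ q : ℝ, 0 < q → _ := fun q hq ↦ hz.exists_volterraNorm_le hW hT hγ0
      (sub_pos.1 hαγ) hα hη.1 hη.2 hζ.1 (hζm.trans (min_le_left _ _))
      (hζm.trans (min_le_right _ _)) hq
    refine ⟨?_, Volterra.aemeasurable_volterraNorm hz.aemeasurable hz.continuous, fun p hp ↦ ?_⟩
    · obtain ⟨K, -, -, hK⟩ := hbound 1 one_pos
      filter_upwards [hK] with ω hω
      exact hω.trans_lt ENNReal.ofReal_lt_top
    · have hp0 : 0 < 2 * p := by linarith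
      obtain ⟨K, hK0, hKq, hK⟩ := hbound (2 * p) hp0
      have hint := lintegral_rpow_enorm_lt_top_of_eLpNorm_lt_top (by simpa using hp0)
        ENNReal.ofReal_ne_top hKq.2
      rw [ENNReal.toReal_ofReal hp0.le] at hint
      refine (lintegral_mono_ae ?_).trans_lt hint
      filter_upwards [hK] with ω hω
      rw [Real.enorm_of_nonneg (hK0 ω)]
      exact ENNReal.rpow_le_rpow hω hp0.le
  · filter_upwards [hW.continuous_paths,
      hz.indistinguishable hW (hW.isFirstLevel_pathLevel hT hγ0)] with ω hω h x hx
    have h01 : x 0 < x 1 := hx.2 (by decide)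
    have h12 : x 1 < x 2 := hx.2 (by decide)
    have h23 : x 2 < x 3 := hx.2 (by decide)
    -- The three faces (s,t,τ), (u,t,τ) and (s,u,τ) carry the identity over from the pathwise
    -- integral, where it holds for every continuous path.
    have e1 := h _ (Volterra.vec_mem_simplex_three (hx.1 0).1 (h01.trans h12) h23 (hx.1 3).2)
    have e2 := h _ (Volterra.vec_mem_simplex_three (hx.1 1).1 h12 h23 (hx.1 3).2)
    have e3 := h _ (Volterra.vec_mem_simplex_three (hx.1 0).1 h01 (h12.trans h23) (hx.1 3).2)
    simp only [Matrix.cons_val] at e1 e2 e3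
    rw [Volterra.delta, e1, e2, e3]
    exact Volterra.delta_pathLevel hω.Icc_extend' h01.le h12.le h23
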